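/- **Setting.** Let $\mathbb{R}_>=(0,\infty)$ and let $L^2(\mathbb{R}_>)$ consist of real-valued (or, alternatively, complex-valued) functions. Let $H^1(\mathbb{R}_>)$ be the space of $u\in L^2(\mathbb{R}_>)$ with weak derivative $u'\in L^2(\mathbb{R}_>)$, with norm $\|u\|_{H^1}^2=\|u\|_{L^2}^2+\|u'\|_{L^2}^2$, and let $H^1_{0,\{0\}}(\mathbb{R}_>)=\{v\in H^1(\mathbb{R}_>): v(0)=0\}$ (in the sense of the continuous representative on $[0,\infty)$). For a Hilbert space $X$ continuously and densely embedded in a Hilbert space $H$, let $\Lambda$ be the positive self-adjoint operator in $H$ with domain $X$ and $\|\Lambda x\|_H=\|x\|_X$ for $x\in X$; for $0\le s\le 1$ the interpolation space $[H,X]_s$ is the domain of $\Lambda^s$ with the graph norm $(\|u\|_H^2+\|\Lambda^s u\|_H^2)^{1/2}$ (so $[H,X]_0=H$ and $[H,X]_1=X$ with equivalent norms). Put $$H^{1/2}(\mathbb{R}_>)=[L^2(\mathbb{R}_>),H^1(\mathbb{R}_>)]_{1/2},\qquad H^{1/2}_{00,\{0\}}(\mathbb{R}_>)=[L^2(\mathbb{R}_>),H^1_{0,\{0\}}(\mathbb{R}_>)]_{1/2}.$$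 A family $(\psi_\lambda)_{\lambda\in\nabla}$ in a Hilbert space $E$ is a *Riesz basis* of $E$ if the synthesis operator $\ell_2(\nabla)\to E$, $c\mapsto\sum_{\lambda} c_\lambda\psi_\lambda$, is well defined and boundedly invertible. **Proposition.** Let $\Theta^X=\{\theta^X_\lambda:\lambda\in\nabla^X\}\subset H^1_{0,\{0\}}(\mathbb{R}_>)$ and $\Theta^Y=\{\theta^Y_\lambda:\lambda\in\nabla^Y\}\subset H^1(\mathbb{R}_>)$ be Riesz bases of $L^2(\mathbb{R}_>)$ such that the renormalized families $\{\theta^X_\lambda/\|\theta^X_\lambda\|_{H^1}\}$ and $\{\theta^Y_\lambda/\|\theta^Y_\lambda\|_{H^1}\}$ are Riesz bases of $H^1_{0,\{0\}}(\mathbb{R}_>)$ and of $H^1(\mathbb{R}_>)$, respectively. Let the level $|\lambda|\in\mathbb{N}_0$ of an index $\lambda$ be such that, for each of the two families, there are constants $0<c\le C<\infty$ with $c\,2^{|\lambda|}\le\|\theta_\lambda\|_{H^1}\le C\,2^{|\lambda|}$ for all $\lambda$. Then for every $0\le s\le 1$ the rescaled families $$[\Theta^X]_s=\{2^{-s|\lambda|}\theta^X_\lambda:\lambda\in\nabla^X\},\qquad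 [\Theta^Y]_s=\{2^{-s|\lambda|}\theta^Y_\lambda:\lambda\in\nabla^Y\}$$ are Riesz bases of $[L^2(\mathbb{R}_>),H^1_{0,\{0\}}(\mathbb{R}_>)]_s$ and of $[L^2(\mathbb{R}_>),H^1(\mathbb{R}_>)]_s$, respectively. In particular, $[\Theta^X]_{1/2}$ is a Riesz basis of $H^{1/2}_{00,\{0\}}(\mathbb{R}_>)$ and $[\Theta^Y]_{1/2}$ is a Riesz basis of $H^{1/2}(\mathbb{R}_>)$. -/

import Mathlib

open MeasureTheory Set Filter Topology
open scoped ContDiff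

namespace HalfLineRiesz

noncomputable section

section FunctionalCalculus

variable {𝕜 H : Type*} [RCLike 𝕜] [NormedAddCommGroup H] [InnerProductSpace 𝕜 H]

/-- `B = f(T)` in the sense of the continuous functional calculus of a bounded positive operator `T`
(whose spectrum lies in `[0, ‖T‖]`): whenever a real polynomial `p` is uniformly `ε`-close to `f` on
`[0, ‖T‖]`, the operator `p(T)` is `ε`-close to `B` in operator norm. For continuous `f` such a `B`
exists and is unique, see `exists_isFunctionalCalculus` and `IsFunctionalCalculus.unique`. -/
def IsFunctionalCalculus (T : H →L[𝕜] H) (f : ℝ → ℝ) (B : H →L[𝕜] H) : Prop :=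
  ∀ (p : Polynomial ℝ) (ε : ℝ), (∀ x ∈ Icc (0 : ℝ) ‖T‖, |p.eval x - f x| ≤ ε) →
    ‖Polynomial.aeval T (p.map (algebraMap ℝ 𝕜)) - B‖ ≤ ε

theorem norm_aeval_apply_le_of_eigenbasis {V : Type*} [NormedAddCommGroup V]
    [InnerProductSpace 𝕜 V] [FiniteDimensional 𝕜 V] (A : V →ₗ[𝕜] V) (hA : A.IsPositive)
    (M : ℝ) (hM : ∀ v, ‖A v‖ ≤ M * ‖v‖) (p : Polynomial ℝ) (C : ℝ)
    (hp : ∀ x ∈ Icc (0 : ℝ) M, |p.eval x| ≤ C) (v : V) :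
    ‖Polynomial.aeval A (p.map (algebraMap ℝ 𝕜)) v‖ ≤ C * ‖v‖ := by
  have hS := hA.isSymmetric
  set b := hS.eigenvectorBasis rfl with hb
  set μ := hS.eigenvalues rfl with hμ
  have hAb : ∀ i, A (b i) = (μ i : 𝕜) • b i := fun i => hS.apply_eigenvectorBasis rfl i
  have hμ0 : ∀ i, μ i ∈ Icc (0 : ℝ) M := by
    intro i
    have h0 : 0 ≤ μ i := hA.nonneg_eigenvalues rfl i
    refine ⟨h0, ?_⟩
    have := hM (b i)
    rw [hAb, norm_smul, b.orthonormal.1 i] at this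
    simpa [abs_of_nonneg h0] using this
  have hpb : ∀ i, Polynomial.aeval A (p.map (algebraMap ℝ 𝕜)) (b i)
      = ((p.eval (μ i) : ℝ) : 𝕜) • b i := by
    intro i
    have hev : Module.End.HasEigenvector A (μ i : 𝕜) (b i) := hS.hasEigenvector_eigenvectorBasis rfl i
    rw [Module.End.aeval_apply_of_hasEigenvector hev]
    congr 1
    rw [Polynomial.eval_map]
    exact Polynomial.eval₂_at_apply (algebraMap ℝ 𝕜) (μ i)
  have hC : 0 ≤ C ∨ v = 0 := by
    by_cases hv : v = 0
    · exact Or.inr hv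
    left
    have hM0 : 0 ≤ M := by
      have h1 := (norm_nonneg _).trans (hM v)
      have h2 : 0 < ‖v‖ := norm_pos_iff.mpr hv
      by_contra hneg
      nlinarith
    exact (abs_nonneg _).trans (hp 0 ⟨le_rfl, hM0⟩)
  rcases hC with hC | hv
  swap
  · simp [hv]
  have hexp : Polynomial.aeval A (p.map (algebraMap ℝ 𝕜)) v
      = ∑ i, (b.repr v i * ((p.eval (μ i) : ℝ) : 𝕜)) • b i := by
    conv_lhs => rw [← b.sum_repr v]
    rw [map_sum]
    refine Finset.sum_congr rfl fun i _ => ?_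
    rw [map_smul, hpb, smul_smul]
  have hsq : ‖Polynomial.aeval A (p.map (algebraMap ℝ 𝕜)) v‖ ^ 2 ≤ (C * ‖v‖) ^ 2 := by
    rw [hexp, ← b.sum_sq_norm_inner_right, mul_pow, ← b.sum_sq_norm_inner_right v,
      Finset.mul_sum]
    refine Finset.sum_le_sum fun i _ => ?_
    rw [b.orthonormal.inner_right_fintype, norm_mul, mul_pow, b.repr_apply_apply, mul_comm]
    gcongr
    simpa using hp _ (hμ0 i)
  exact le_of_sq_le_sq hsq (by positivity)

theorem norm_aeval_le_of_isPositive (T : H →L[𝕜] H) (hT : T.IsPositive) (p : Polynomial ℝ)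
    (C : ℝ) (hp : ∀ x ∈ Icc (0 : ℝ) ‖T‖, |p.eval x| ≤ C) :
    ‖Polynomial.aeval T (p.map (algebraMap ℝ 𝕜))‖ ≤ C := by
  have hC : 0 ≤ C := (abs_nonneg _).trans (hp 0 ⟨le_rfl, norm_nonneg _⟩)
  refine ContinuousLinearMap.opNorm_le_bound _ hC fun x => ?_
  set q := p.map (algebraMap ℝ 𝕜) with hq
  set n := q.natDegree with hn
  let V : Submodule 𝕜 H := Submodule.span 𝕜 (Set.range fun k : Fin (n + 1) => (T ^ (k : ℕ)) x)
  have : FiniteDimensional 𝕜 V := FiniteDimensional.span_of_finite 𝕜 (Set.finite_range _)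
  have hV : ∀ k ≤ n, (T ^ k) x ∈ V := fun k hk =>
    Submodule.subset_span ⟨⟨k, Nat.lt_succ_of_le hk⟩, rfl⟩
  let A : V →L[𝕜] V := V.orthogonalProjectionOnto ∘L T ∘L V.subtypeL
  have hA : A.IsPositive := hT.orthogonalProjectionOnto_comp V
  let x0 : V := ⟨x, by simpa using hV 0 (Nat.zero_le _)⟩
  have hpow : ∀ k ≤ n, (((A : V →ₗ[𝕜] V) ^ k) x0 : H) = (T ^ k) x := by
    intro k
    induction k with
    | zero => intro _; simp [x0]
    | succ k ih =>
      intro hk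
      have h1 := ih (by omega)
      rw [pow_succ', pow_succ', Module.End.mul_apply, mul_apply_eq_comp, ← h1]
      change ((V.orthogonalProjectionOnto (T ((((A : V →ₗ[𝕜] V) ^ k) x0 : V) : H)) : V) : H) = _
      have h2 : T ((((A : V →ₗ[𝕜] V) ^ k) x0 : V) : H) ∈ V := by
        rw [h1]
        have := hV (k + 1) hk
        rwa [pow_succ', mul_apply_eq_comp] at this
      exact congrArg Subtype.val (V.orthogonalProjectionOnto_mem_subspace_eq_self ⟨_, h2⟩)
  have hM : ∀ v : V, ‖(A : V →ₗ[𝕜] V) v‖ ≤ ‖T‖ * ‖v‖ := by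
    intro v
    change ‖V.orthogonalProjectionOnto (T (v : H))‖ ≤ _
    exact (V.norm_orthogonalProjectionOnto_apply_le _).trans (T.le_opNorm _)
  have key := norm_aeval_apply_le_of_eigenbasis (A : V →ₗ[𝕜] V) hA ‖T‖ hM p C hp x0
  have heq : ((Polynomial.aeval (A : V →ₗ[𝕜] V) q x0 : V) : H) = Polynomial.aeval T q x := by
    rw [Polynomial.aeval_eq_sum_range, Polynomial.aeval_eq_sum_range]
    simp only [LinearMap.sum_apply, sum_apply, LinearMap.smul_apply,
      smul_apply, Submodule.coe_sum, Submodule.coe_smul]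
    refine Finset.sum_congr rfl fun k hk => ?_
    rw [hpow k (by simpa [Nat.lt_succ_iff] using hk)]
  rw [← heq]
  exact key

theorem exists_isFunctionalCalculus [CompleteSpace H] (T : H →L[𝕜] H) (hT : T.IsPositive)
    (f : ℝ → ℝ) (hf : ContinuousOn f (Icc 0 ‖T‖)) : ∃ B, IsFunctionalCalculus T f B := by
  have hpos : ∀ n : ℕ, (0 : ℝ) < 1 / ((n : ℝ) + 1) := fun n => Nat.one_div_pos_of_nat
  choose P hP using fun n : ℕ =>
    exists_polynomial_near_of_continuousOn 0 ‖T‖ f hf (1 / ((n : ℝ) + 1)) (hpos n)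
  have hdiff : ∀ p q : Polynomial ℝ, ∀ C : ℝ,
      (∀ x ∈ Icc (0 : ℝ) ‖T‖, |p.eval x - q.eval x| ≤ C) →
      ‖Polynomial.aeval T (p.map (algebraMap ℝ 𝕜))
        - Polynomial.aeval T (q.map (algebraMap ℝ 𝕜))‖ ≤ C := by
    intro p q C h
    rw [← map_sub, ← Polynomial.map_sub]
    exact norm_aeval_le_of_isPositive T hT _ C (by simpa using h)
  have hlim := tendsto_one_div_add_atTop_nhds_zero_nat (𝕜 := ℝ)
  have hcau : CauchySeq fun n => Polynomial.aeval T ((P n).map (algebraMap ℝ 𝕜)) := by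
    refine cauchySeq_of_le_tendsto_0 (fun n => 2 * (1 / ((n : ℝ) + 1))) ?_ ?_
    · intro n m N hn hm
      rw [dist_eq_norm]
      refine hdiff _ _ _ fun x hx => ?_
      have h1 := hP n x hx
      have h2 := hP m x hx
      have h3 : 1 / ((n : ℝ) + 1) ≤ 1 / ((N : ℝ) + 1) := Nat.one_div_le_one_div hn
      have h4 : 1 / ((m : ℝ) + 1) ≤ 1 / ((N : ℝ) + 1) := Nat.one_div_le_one_div hm
      rw [abs_lt] at h1 h2
      rw [abs_le]
      constructor <;> linarith
    · simpa using hlim.const_mul 2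
  obtain ⟨B, hB⟩ := cauchySeq_tendsto_of_complete hcau
  refine ⟨B, fun p ε h => ?_⟩
  have h1 : Tendsto (fun n => ‖Polynomial.aeval T (p.map (algebraMap ℝ 𝕜))
      - Polynomial.aeval T ((P n).map (algebraMap ℝ 𝕜))‖) atTop
      (𝓝 ‖Polynomial.aeval T (p.map (algebraMap ℝ 𝕜)) - B‖) :=
    (tendsto_const_nhds.sub hB).norm
  have h2 : Tendsto (fun n : ℕ => ε + 1 / ((n : ℝ) + 1)) atTop (𝓝 (ε + 0)) :=
    tendsto_const_nhds.add hlim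
  rw [add_zero] at h2
  refine le_of_tendsto_of_tendsto' h1 h2 fun n => hdiff _ _ _ fun x hx => ?_
  have h3 := hP n x hx
  have h4 := h x hx
  rw [abs_lt] at h3
  rw [abs_le] at h4 ⊢
  constructor <;> linarith

theorem IsFunctionalCalculus.unique {T : H →L[𝕜] H} {f : ℝ → ℝ}
    (hf : ContinuousOn f (Icc 0 ‖T‖)) {B B' : H →L[𝕜] H} (hB : IsFunctionalCalculus T f B)
    (hB' : IsFunctionalCalculus T f B') : B = B' := by
  rw [← sub_eq_zero, ← norm_le_zero_iff]
  refine le_of_forall_pos_le_add fun ε hε => ?_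
  obtain ⟨p, hp⟩ := exists_polynomial_near_of_continuousOn 0 ‖T‖ f hf (ε / 2) (half_pos hε)
  have h1 := hB p (ε / 2) fun x hx => (hp x hx).le
  have h2 := hB' p (ε / 2) fun x hx => (hp x hx).le
  calc ‖B - B'‖ = ‖(Polynomial.aeval T (p.map (algebraMap ℝ 𝕜)) - B')
        - (Polynomial.aeval T (p.map (algebraMap ℝ 𝕜)) - B)‖ := by congr 1; abel
    _ ≤ _ := norm_sub_le _ _
    _ ≤ 0 + ε := by linarith

open Classical in
/-- The power `T ^ r` (`r ≥ 0`) of a bounded positive operator, by functional calculus. -/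
def fracPow (T : H →L[𝕜] H) (r : ℝ) : H →L[𝕜] H :=
  if h : ∃ B, IsFunctionalCalculus T (fun x => x ^ r) B then h.choose else 0

theorem fracPow_spec [CompleteSpace H] (T : H →L[𝕜] H) (hT : T.IsPositive) (r : ℝ) (hr : 0 ≤ r) :
    IsFunctionalCalculus T (fun x => x ^ r) (fracPow T r) := by
  have h : ∃ B, IsFunctionalCalculus T (fun x => x ^ r) B :=
    exists_isFunctionalCalculus T hT _
      (continuousOn_id.rpow_const fun _ _ => Or.inr hr)
  rw [fracPow, dif_pos h]
  exact h.choose_spec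

end FunctionalCalculus

section Interpolation

variable {𝕜 H X : Type*} [RCLike 𝕜]
  [NormedAddCommGroup H] [InnerProductSpace 𝕜 H] [CompleteSpace H]
  [NormedAddCommGroup X] [InnerProductSpace 𝕜 X] [CompleteSpace X]

/-- For a continuous dense embedding `j : X → H` of Hilbert spaces let `Λ` be the positive
self-adjoint operator in `H` with domain `X` and `‖Λ x‖_H = ‖x‖_X`; that is, `Λ = S ^ (1/2)`, where
`S` is the self-adjoint operator associated with the form `⟪·,·⟫_X`,
`⟪S u, j v⟫_H = ⟪u, v⟫_X` for all `v ∈ X`. Then `S⁻¹ = Λ⁻² = j ∘ j†`, a bounded positive operator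
on `H`. This definition is the operator `Λ⁻²`. -/
def invSqOp (j : X →L[𝕜] H) : H →L[𝕜] H := j ∘L ContinuousLinearMap.adjoint j

theorem isPositive_invSqOp (j : X →L[𝕜] H) : (invSqOp j).IsPositive :=
  ContinuousLinearMap.isPositive_self_comp_adjoint j

/-- The interpolation space `[H, X]_s = D(Λ ^ s)`, `0 ≤ s ≤ 1`, of Lions and Magenes, where
`D(Λ) = X`, so that `[H, X]_0 = H` and `[H, X]_1 = X`. It is realized as the graph of `Λ ^ s`: its
elements are the pairs `(u, v)` with `v = Λ ^ s u`, that is, `u = Λ ^ (-s) v = (Λ⁻²) ^ (s / 2) v`,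
and its norm is the graph norm `(‖u‖² + ‖Λ ^ s u‖²) ^ (1/2)`. -/
def interpSpace (j : X →L[𝕜] H) (s : ℝ) : Submodule 𝕜 (WithLp 2 (H × H)) where
  carrier := {z | z.fst = fracPow (invSqOp j) (s / 2) z.snd}
  zero_mem' := by simp
  add_mem' := by
    intro x y hx hy
    simp only [mem_ofPred_eq] at hx hy ⊢
    rw [WithLp.add_fst, WithLp.add_snd, map_add, hx, hy]
  smul_mem' := by
    intro c x hx
    simp only [mem_ofPred_eq] at hx ⊢
    rw [WithLp.smul_fst, WithLp.smul_snd, map_smul, hx]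

/-- The inclusion `[H, X]_s → H`, `(u, Λ ^ s u) ↦ u`. -/
def interpIncl (j : X →L[𝕜] H) (s : ℝ) : interpSpace j s →L[𝕜] H :=
  WithLp.fstL 2 𝕜 H H ∘L (interpSpace j s).subtypeL

end Interpolation

section RieszBasis

variable {ι E F : Type*} (𝕜 : Type*) [RCLike 𝕜] [NormedAddCommGroup E] [NormedSpace 𝕜 E]
  [NormedAddCommGroup F] [NormedSpace 𝕜 F]

/-- `θ` is a Riesz basis of `E`: the synthesis operator `c ↦ ∑ i, c i • θ i` is (well defined and)
boundedly invertible from `ℓ²(ι)` onto `E`. -/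
def IsRieszBasis (θ : ι → E) : Prop :=
  ∃ S : lp (fun _ : ι => 𝕜) 2 ≃L[𝕜] E, ∀ c, HasSum (fun i => c i • θ i) (S c)

variable {𝕜} in
/-- The family `f` of elements of the ambient space `F` lies in the space `E`, included in `F` by
`e`, and it is a Riesz basis of `E`. -/
def IsRieszBasisOf (e : E →L[𝕜] F) (f : ι → F) : Prop :=
  ∃ θ : ι → E, (∀ i, e (θ i) = f i) ∧ IsRieszBasis 𝕜 θ

end RieszBasis

section HalfLine

/-- `L²(0,∞)` with scalars `𝕜 = ℝ` or `ℂ`. -/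
abbrev L2Half (𝕜 : Type*) [RCLike 𝕜] : Type _ := Lp 𝕜 2 (volume.restrict (Ioi (0 : ℝ)))

variable {𝕜 : Type*} [RCLike 𝕜]

/-- `w` is the weak (distributional) derivative of `u` on `(0,∞)`: the identity `∫ φ' u = -∫ φ w`
holds for all smooth `φ` with compact support contained in `(0,∞)`. -/
def IsWeakDeriv (u w : L2Half 𝕜) : Prop :=
  ∀ φ : ℝ → ℝ, ContDiff ℝ ∞ φ → HasCompactSupport φ → tsupport φ ⊆ Ioi 0 →
    ∫ x in Ioi (0 : ℝ), deriv φ x • u x = -∫ x in Ioi (0 : ℝ), φ x • w x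

theorem exists_integral_smul_eq_inner (𝕜 : Type*) [RCLike 𝕜] (ψ : ℝ → ℝ) (hψ : Continuous ψ)
    (hψc : HasCompactSupport ψ) :
    ∃ g : L2Half 𝕜, ∀ u : L2Half 𝕜, ∫ x in Ioi (0 : ℝ), ψ x • u x = inner 𝕜 g u := by
  have hm : MemLp (fun x => (ψ x : 𝕜)) 2 (volume.restrict (Ioi (0 : ℝ))) := by
    refine (Continuous.memLp_of_hasCompactSupport (RCLike.continuous_ofReal.comp hψ) ?_).restrict _
    exact hψc.comp_left RCLike.ofReal_zero
  refine ⟨hm.toLp _, fun u => ?_⟩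
  rw [L2.inner_def]
  refine integral_congr_ae ?_
  filter_upwards [hm.coeFn_toLp] with x hx
  rw [hx, RCLike.inner_apply, RCLike.conj_ofReal, mul_comm, ← RCLike.real_smul_eq_coe_mul]

theorem isWeakDeriv_iff_inner (u w : L2Half 𝕜) : IsWeakDeriv u w ↔
    ∀ a b : L2Half 𝕜, (∃ φ : ℝ → ℝ, (ContDiff ℝ ∞ φ ∧ HasCompactSupport φ ∧ tsupport φ ⊆ Ioi 0) ∧
      (∀ v : L2Half 𝕜, ∫ x in Ioi (0 : ℝ), deriv φ x • v x = inner 𝕜 a v) ∧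
      (∀ v : L2Half 𝕜, ∫ x in Ioi (0 : ℝ), φ x • v x = inner 𝕜 b v)) →
      inner 𝕜 a u = -inner 𝕜 b w := by
  constructor
  · rintro h a b ⟨φ, ⟨h1, h2, h3⟩, ha, hb⟩
    rw [← ha, ← hb]
    exact h φ h1 h2 h3
  · intro h φ h1 h2 h3
    obtain ⟨a, ha⟩ := exists_integral_smul_eq_inner 𝕜 (deriv φ)
      (h1.continuous_deriv (by simp)) h2.deriv
    obtain ⟨b, hb⟩ := exists_integral_smul_eq_inner 𝕜 φ h1.continuous h2
    rw [ha, hb]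
    exact h a b ⟨φ, ⟨h1, h2, h3⟩, ha, hb⟩

variable (𝕜) in
/-- The Sobolev space `H¹(0,∞)`, as the space of pairs `(u, u')` in `L² × L²` such that `u'` is the
weak derivative of `u`. The norm is `‖(u, u')‖² = ‖u‖² + ‖u'‖²` in `L²`. -/
def H1Half : Submodule 𝕜 (WithLp 2 (L2Half 𝕜 × L2Half 𝕜)) where
  carrier := {z | IsWeakDeriv z.fst z.snd}
  zero_mem' := by
    simp only [mem_ofPred_eq, isWeakDeriv_iff_inner]
    intro a b _
    simp
  add_mem' := by
    simp only [mem_ofPred_eq, isWeakDeriv_iff_inner]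
    intro x y hx hy a b h
    rw [WithLp.add_fst, WithLp.add_snd, inner_add_right, inner_add_right, hx a b h, hy a b h]
    ring
  smul_mem' := by
    simp only [mem_ofPred_eq, isWeakDeriv_iff_inner]
    intro c x hx a b h
    rw [WithLp.smul_fst, WithLp.smul_snd, inner_smul_right, inner_smul_right, hx a b h]
    ring

theorem isClosed_H1Half : IsClosed (H1Half 𝕜 : Set (WithLp 2 (L2Half 𝕜 × L2Half 𝕜))) := by
  have : (H1Half 𝕜 : Set (WithLp 2 (L2Half 𝕜 × L2Half 𝕜))) = {z | IsWeakDeriv z.fst z.snd} := rfl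
  rw [this]
  simp only [isWeakDeriv_iff_inner, ofPred_forall]
  refine isClosed_iInter fun a => isClosed_iInter fun b => isClosed_iInter fun _ => ?_
  have h1 : Continuous fun z : WithLp 2 (L2Half 𝕜 × L2Half 𝕜) => z.fst :=
    (WithLp.fstL 2 𝕜 (L2Half 𝕜) (L2Half 𝕜)).continuous
  have h2 : Continuous fun z : WithLp 2 (L2Half 𝕜 × L2Half 𝕜) => z.snd :=
    (WithLp.sndL 2 𝕜 (L2Half 𝕜) (L2Half 𝕜)).continuous
  exact isClosed_eq (continuous_const.inner h1) (continuous_const.inner h2).neg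

theorem integrableOn_Ioc_of_L2 (w : L2Half 𝕜) (b : ℝ) : IntegrableOn w (Ioc 0 b) := by
  have h : MemLp w 2 (volume.restrict (Ioc 0 b)) :=
    (Lp.memLp w).mono_measure (Measure.restrict_mono Ioc_subset_Ioi_self le_rfl)
  exact h.integrable (by norm_num)

/-- Integration by parts against a test function for the primitive of an `L²` function. -/
theorem integral_deriv_smul_primitive (w : L2Half 𝕜) (φ : ℝ → ℝ) (h1 : ContDiff ℝ ∞ φ)
    (h2 : HasCompactSupport φ) :
    ∫ x in Ioi (0 : ℝ), deriv φ x • ∫ t in (0 : ℝ)..x, w t = -∫ x in Ioi (0 : ℝ), φ x • w x := by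
  have hcd : Continuous (deriv φ) := h1.continuous_deriv (by simp)
  obtain ⟨b, hb⟩ := h2.isCompact.bddAbove
  have hφ0 : ∀ x, b < x → φ x = 0 := fun x hx =>
    image_eq_zero_of_notMem_tsupport fun h => absurd (hb h) (not_le.mpr hx)
  have hφ'0 : ∀ x, b < x → deriv φ x = 0 := fun x hx => by
    by_contra hne
    exact absurd (hb (support_deriv_subset (Function.mem_support.mpr hne))) (not_le.mpr hx)
  have hw : IntegrableOn w (Ioc 0 b) := integrableOn_Ioc_of_L2 w b
  set wb : ℝ → 𝕜 := (Ioc 0 b).indicator w with hwb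
  have hwbi : Integrable wb (volume.restrict (Ioi (0 : ℝ))) :=
    ((integrable_indicator_iff measurableSet_Ioc).mpr hw).integrableOn
  have hd : Integrable (deriv φ) (volume.restrict (Ioi (0 : ℝ))) :=
    (hcd.integrable_of_hasCompactSupport h2.deriv).integrableOn
  let F : ℝ → ℝ → 𝕜 := fun x t => (Iio x).indicator (fun t => deriv φ x • wb t) t
  have hF : Integrable (Function.uncurry F)
      ((volume.restrict (Ioi (0 : ℝ))).prod (volume.restrict (Ioi (0 : ℝ)))) := by
    have hS : MeasurableSet {p : ℝ × ℝ | p.2 < p.1} := measurableSet_lt measurable_snd measurable_fst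
    have : Function.uncurry F
        = {p : ℝ × ℝ | p.2 < p.1}.indicator fun p => deriv φ p.1 • wb p.2 := by
      ext ⟨x, t⟩
      simp [F, Set.indicator, Function.uncurry]
    rw [this]
    exact (hd.smul_prod hwbi).indicator hS
  have hl : ∀ x ∈ Ioi (0 : ℝ), ∫ t in Ioi (0 : ℝ), F x t = deriv φ x • ∫ t in (0 : ℝ)..x, w t := by
    intro x hx
    rcases lt_or_ge b x with hbx | hbx
    · simp [F, hφ'0 x hbx]
    have hx0 : (0 : ℝ) ≤ x := le_of_lt hx
    rw [setIntegral_indicator measurableSet_Iio, integral_smul, Ioi_inter_Iio,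
      ← integral_Ioc_eq_integral_Ioo, intervalIntegral.integral_of_le hx0]
    congr 1
    refine setIntegral_congr_fun measurableSet_Ioc fun t ht => ?_
    simp only [hwb]
    exact Set.indicator_of_mem (show t ∈ Ioc 0 b from ⟨ht.1, ht.2.trans hbx⟩) _
  have hr : ∀ t ∈ Ioi (0 : ℝ), ∫ x in Ioi (0 : ℝ), F x t = -(φ t • w t) := by
    intro t ht
    have e1 : ∀ x, F x t = (Ioi t).indicator (fun x => deriv φ x • wb t) x := by
      intro x
      simp [F, Set.indicator]
    simp_rw [e1]
    rw [setIntegral_indicator measurableSet_Ioi, Ioi_inter_Ioi, sup_eq_right.mpr (le_of_lt ht),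
      integral_smul_const, HasCompactSupport.integral_Ioi_deriv_eq (h1.of_le (by simp)) h2 t,
      neg_smul]
    rcases lt_or_ge b t with hbt | hbt
    · simp [hφ0 t hbt]
    · rw [hwb, Set.indicator_of_mem (show t ∈ Ioc 0 b from ⟨ht, hbt⟩)]
  rw [← setIntegral_congr_fun measurableSet_Ioi hl, integral_integral_swap hF,
    setIntegral_congr_fun measurableSet_Ioi hr, integral_neg]

/-- The fundamental lemma of the calculus of variations in first order form. -/
theorem ae_eq_const_of_forall_integral_deriv_eq_zero (v : ℝ → 𝕜)
    (hv : LocallyIntegrableOn v (Ioi 0))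
    (h : ∀ φ : ℝ → ℝ, ContDiff ℝ ∞ φ → HasCompactSupport φ → tsupport φ ⊆ Ioi 0 →
      ∫ x in Ioi (0 : ℝ), deriv φ x • v x = 0) :
    ∃ c : 𝕜, ∀ᵐ x ∂volume.restrict (Ioi (0 : ℝ)), v x = c := by
  have hint : ∀ φ : ℝ → ℝ, Continuous φ → HasCompactSupport φ → tsupport φ ⊆ Ioi 0 →
      Integrable (fun x => φ x • v x) := by
    intro φ h1 h2 h3
    have hK : IntegrableOn v (tsupport φ) := hv.integrableOn_compact_subset h3 h2
    have hKi : IntegrableOn (fun x => φ x • v x) (tsupport φ) :=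
      hK.continuousOn_smul h1.continuousOn h2
    refine (integrableOn_iff_integrable_of_support_subset ?_).mp hKi
    exact (Function.support_smul_subset_left _ _).trans (subset_tsupport φ)
  have hfull : ∀ φ : ℝ → ℝ, tsupport φ ⊆ Ioi 0 →
      ∫ x in Ioi (0 : ℝ), φ x • v x = ∫ x, φ x • v x := by
    intro φ h3
    refine setIntegral_eq_integral_of_forall_compl_eq_zero fun x hx => ?_
    rw [image_eq_zero_of_notMem_tsupport fun hh => hx (h3 hh), zero_smul]
  let θ : ContDiffBump (2 : ℝ) := ⟨1 / 2, 1, by norm_num, by norm_num⟩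
  let θ0 : ℝ → ℝ := θ.normed volume
  have t1 : ContDiff ℝ ∞ θ0 := θ.contDiff_normed
  have t2 : HasCompactSupport θ0 := θ.hasCompactSupport_normed
  have t3 : tsupport θ0 ⊆ Ioi 0 := by
    rw [show tsupport θ0 = Metric.closedBall 2 1 from θ.tsupport_normed_eq, Real.closedBall_eq_Icc]
    intro x hx
    have := hx.1
    simp only [mem_Ioi]
    linarith
  have t4 : ∫ x, θ0 x = 1 := θ.integral_normed
  set c : 𝕜 := ∫ x, θ0 x • v x with hc
  refine ⟨c, ?_⟩
  have key : ∀ᵐ x, x ∈ Ioi (0 : ℝ) → v x - c = 0 := by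
    refine isOpen_Ioi.ae_eq_zero_of_integral_contDiff_smul_eq_zero
      (hv.sub ((locallyIntegrable_const c).locallyIntegrableOn _)) ?_
    intro ψ p1 p2 p3
    set m : ℝ := ∫ x, ψ x with hm
    let η : ℝ → ℝ := fun x => ψ x - m * θ0 x
    have e1 : ContDiff ℝ ∞ η := p1.sub (contDiff_const.mul t1)
    have eint : Integrable η := (p1.continuous.integrable_of_hasCompactSupport p2).sub
      ((t1.continuous.integrable_of_hasCompactSupport t2).const_mul m)
    have e0 : ∫ x, η x = 0 := by
      rw [integral_sub (p1.continuous.integrable_of_hasCompactSupport p2)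
        ((t1.continuous.integrable_of_hasCompactSupport t2).const_mul m), integral_const_mul, t4]
      simp [hm]
    have hKc : IsCompact (tsupport ψ ∪ tsupport θ0) := p2.isCompact.union t2.isCompact
    have hK0 : tsupport ψ ∪ tsupport θ0 ⊆ Ioi 0 := union_subset p3 t3
    have hKne : (tsupport ψ ∪ tsupport θ0).Nonempty := by
      refine ⟨2, Or.inr ?_⟩
      rw [show tsupport θ0 = Metric.closedBall 2 1 from θ.tsupport_normed_eq]
      simp
    obtain ⟨a, ha⟩ := hKc.exists_isLeast hKne
    obtain ⟨b, hb⟩ := hKc.exists_isGreatest hKne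
    have hη : ∀ x, x ∉ Icc a b → η x = 0 := by
      intro x hx
      have hx' : x ∉ tsupport ψ ∪ tsupport θ0 := fun h' => hx ⟨ha.2 h', hb.2 h'⟩
      rw [mem_union, not_or] at hx'
      simp [η, image_eq_zero_of_notMem_tsupport hx'.1, image_eq_zero_of_notMem_tsupport hx'.2]
    let φ : ℝ → ℝ := fun x => ∫ t in a..x, η t
    have hφd : ∀ x, HasDerivAt φ (η x) x := fun x =>
      intervalIntegral.integral_hasDerivAt_right (e1.continuous.intervalIntegrable _ _)
        (e1.continuous.stronglyMeasurableAtFilter _ _) e1.continuous.continuousAt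
    have hφd' : deriv φ = η := funext fun x => (hφd x).deriv
    have q1 : ContDiff ℝ ∞ φ := by
      rw [contDiff_infty_iff_deriv, hφd']
      exact ⟨fun x => (hφd x).differentiableAt, e1⟩
    have q0 : ∀ x, x ∉ Icc a b → φ x = 0 := by
      intro x hx
      rcases lt_or_ge x a with hxa | hxa
      · refine intervalIntegral.integral_zero_ae ?_
        have hane : ∀ᵐ t : ℝ, t ≠ a := by simp [ae_iff, measure_singleton]
        filter_upwards [hane] with t hta ht
        rw [uIoc_of_ge hxa.le] at ht
        exact hη t fun hh => hta (le_antisymm ht.2 hh.1)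
      · have hbx : b < x := by
          by_contra hh
          exact hx ⟨hxa, not_lt.mp hh⟩
        have hab : a ≤ x := hxa
        change ∫ t in a..x, η t = 0
        rw [intervalIntegral.integral_of_le hab, ← integral_Icc_eq_integral_Ioc, ← e0]
        refine setIntegral_eq_integral_of_forall_compl_eq_zero fun t ht => hη t fun hh => ht ?_
        exact ⟨hh.1, hh.2.trans hbx.le⟩
    have qs : tsupport φ ⊆ Icc a b :=
      closure_minimal (fun x hx => by
        by_contra hh
        exact hx (q0 x hh)) isClosed_Icc
    have q2 : HasCompactSupport φ := isCompact_Icc.of_isClosed_subset (isClosed_tsupport φ) qs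
    have q3 : tsupport φ ⊆ Ioi 0 := qs.trans fun x hx => lt_of_lt_of_le (hK0 ha.1) hx.1
    have hz := h φ q1 q2 q3
    have hηs : tsupport η ⊆ Ioi 0 := by
      refine (closure_minimal (t := Icc a b) (fun x hx => ?_) isClosed_Icc).trans
        fun x hx => lt_of_lt_of_le (hK0 ha.1) hx.1
      by_contra hh
      exact hx (hη x hh)
    rw [hφd', hfull η hηs] at hz
    have hsplit : ∫ x, η x • v x = (∫ x, ψ x • v x) - m • c := by
      have : ∀ x, η x • v x = ψ x • v x - m • (θ0 x • v x) := fun x => by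
        rw [smul_smul, ← sub_smul]
      simp_rw [this]
      have hi : Integrable (fun x => m • (θ0 x • v x)) := (hint θ0 t1.continuous t2 t3).smul m
      rw [integral_sub (hint ψ p1.continuous p2 p3) hi, integral_smul]
    rw [hsplit] at hz
    have hψi : Integrable (fun x => ψ x • c) :=
      (p1.continuous.integrable_of_hasCompactSupport p2).smul_const c
    simp_rw [smul_sub]
    rw [integral_sub (hint ψ p1.continuous p2 p3) hψi, integral_smul_const]
    exact hz
  rw [ae_restrict_iff' measurableSet_Ioi]
  filter_upwards [key] with x hx hx0
  exact sub_eq_zero.mp (hx hx0)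


variable (𝕜) in
/-- `H¹_{0,{0}}(0,∞)`: the elements `(u, u')` of `H¹(0,∞)` with `u(0) = 0`, that is, `u` has a
representative which is continuous on `[0,∞)` and vanishes at `0`. The norm is that of `H¹`. -/
def H10Half : Submodule 𝕜 (WithLp 2 (L2Half 𝕜 × L2Half 𝕜)) where
  carrier := {z | z ∈ H1Half 𝕜 ∧ ∃ g : ℝ → 𝕜, ContinuousOn g (Ici 0) ∧ g 0 = 0 ∧
    z.fst =ᵐ[volume.restrict (Ioi (0 : ℝ))] g}
  zero_mem' := ⟨zero_mem _, 0, continuousOn_const, rfl, Lp.coeFn_zero _ _ _⟩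
  add_mem' := by
    rintro x y ⟨hx, g, g1, g2, g3⟩ ⟨hy, k, k1, k2, k3⟩
    refine ⟨add_mem hx hy, g + k, g1.add k1, by simp [g2, k2], ?_⟩
    rw [WithLp.add_fst]
    exact (Lp.coeFn_add _ _).trans (g3.add k3)
  smul_mem' := by
    rintro c x ⟨hx, g, g1, g2, g3⟩
    refine ⟨Submodule.smul_mem _ c hx, c • g, g1.const_smul c, by simp [g2], ?_⟩
    rw [WithLp.smul_fst]
    exact (Lp.coeFn_smul _ _).trans (g3.const_smul c)

theorem continuousOn_primitive_L2 (w : L2Half 𝕜) :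
    ContinuousOn (fun x => ∫ t in (0 : ℝ)..x, w t) (Ici 0) := by
  intro x hx
  have hx : (0 : ℝ) ≤ x := hx
  have h : ContinuousOn (fun x => ∫ t in (0 : ℝ)..x, w t) (Icc 0 (x + 1)) := by
    have hu : uIcc 0 (x + 1) = Icc 0 (x + 1) := uIcc_of_le (by linarith)
    rw [← hu]
    refine intervalIntegral.continuousOn_primitive_interval (f := w) (μ := volume) ?_
    rw [hu, integrableOn_Icc_iff_integrableOn_Ioc]
    exact integrableOn_Ioc_of_L2 w _
  refine (h x ⟨hx, by linarith⟩).mono_of_mem_nhdsWithin ?_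
  rw [← Ici_inter_Iic]
  exact inter_mem self_mem_nhdsWithin (mem_nhdsWithin_of_mem_nhds (Iic_mem_nhds (by linarith)))

theorem mem_H10Half_iff (z : WithLp 2 (L2Half 𝕜 × L2Half 𝕜)) : z ∈ H10Half 𝕜 ↔
    z ∈ H1Half 𝕜 ∧ ∀ᵐ x ∂volume.restrict (Ioi (0 : ℝ)), z.fst x = ∫ t in (0 : ℝ)..x, z.snd t := by
  constructor
  swap
  · rintro ⟨h1, h2⟩
    exact ⟨h1, _, continuousOn_primitive_L2 z.snd, by simp, h2⟩
  rintro ⟨h1, g, g1, g2, g3⟩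
  refine ⟨h1, ?_⟩
  set W : ℝ → 𝕜 := fun x => ∫ t in (0 : ℝ)..x, z.snd t with hW
  have hWc : ContinuousOn W (Ici 0) := continuousOn_primitive_L2 z.snd
  have hvc : ContinuousOn (fun x => g x - W x) (Ici 0) := g1.sub hWc
  obtain ⟨c, hc⟩ := ae_eq_const_of_forall_integral_deriv_eq_zero (fun x => g x - W x)
    ((hvc.mono Ioi_subset_Ici_self).locallyIntegrableOn measurableSet_Ioi) (by
      intro φ p1 p2 p3
      have hcd : Continuous (deriv φ) := p1.continuous_deriv (by simp)
      have hi : ∀ f : ℝ → 𝕜, ContinuousOn f (Ici 0) →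
          IntegrableOn (fun x => deriv φ x • f x) (Ioi 0) := by
        intro f hf
        have hsub : tsupport (deriv φ) ⊆ Ioi 0 :=
          (closure_minimal support_deriv_subset (isClosed_tsupport φ)).trans p3
        have hf' : ContinuousOn f (tsupport (deriv φ)) :=
          hf.mono (hsub.trans Ioi_subset_Ici_self)
        have h' : IntegrableOn (fun x => deriv φ x • f x) (tsupport (deriv φ)) :=
          (hcd.continuousOn.smul hf').integrableOn_compact p2.deriv
        refine ((integrableOn_iff_integrable_of_support_subset ?_).mp h').integrableOn
        exact (Function.support_smul_subset_left (deriv φ) f).trans (subset_tsupport (deriv φ))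
      simp_rw [smul_sub]
      rw [integral_sub (hi g g1) (hi W hWc), sub_eq_zero,
        integral_deriv_smul_primitive z.snd φ p1 p2, ← h1 φ p1 p2 p3]
      refine integral_congr_ae ?_
      filter_upwards [g3] with x hx
      rw [hx])
  have hcall : ∀ x ∈ Ioi (0 : ℝ), g x - W x = c := by
    have := Measure.eqOn_open_of_ae_eq hc isOpen_Ioi (hvc.mono Ioi_subset_Ici_self)
      continuousOn_const
    exact this
  have hc0 : c = 0 := by
    have l1 : Tendsto (fun x => g x - W x) (𝓝[>] 0) (𝓝 (g 0 - W 0)) :=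
      (hvc 0 self_mem_Ici).mono_left (nhdsWithin_mono _ Ioi_subset_Ici_self)
    have l2 : Tendsto (fun x => g x - W x) (𝓝[>] 0) (𝓝 c) :=
      tendsto_const_nhds.congr' (by
        filter_upwards [self_mem_nhdsWithin] with x hx
        exact (hcall x hx).symm)
    have := tendsto_nhds_unique l1 l2
    simpa [g2, hW] using this.symm
  filter_upwards [g3, ae_restrict_mem measurableSet_Ioi] with x hx hx0
  rw [hx]
  have := hcall x hx0
  rw [hc0] at this
  exact sub_eq_zero.mp this

theorem tendsto_primitive_L2 {w : ℕ → L2Half 𝕜} {w' : L2Half 𝕜} (h : Tendsto w atTop (𝓝 w'))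
    {x : ℝ} (hx : 0 ≤ x) :
    Tendsto (fun n => ∫ t in (0 : ℝ)..x, w n t) atTop (𝓝 (∫ t in (0 : ℝ)..x, w' t)) := by
  have hm : MemLp ((Ioc 0 x).indicator fun _ => (1 : 𝕜)) 2 (volume.restrict (Ioi (0 : ℝ))) :=
    memLp_indicator_const _ measurableSet_Ioc _ (Or.inr (by
      rw [Measure.restrict_apply measurableSet_Ioc]
      exact ((measure_mono inter_subset_left).trans_lt measure_Ioc_lt_top).ne))
  have key : ∀ u : L2Half 𝕜, ∫ t in (0 : ℝ)..x, u t = inner 𝕜 (hm.toLp _) u := by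
    intro u
    rw [L2.inner_def, intervalIntegral.integral_of_le hx]
    have e : ∀ᵐ t ∂volume.restrict (Ioi (0 : ℝ)),
        inner 𝕜 (hm.toLp _ t) (u t) = (Ioc 0 x).indicator u t := by
      filter_upwards [hm.coeFn_toLp] with t ht
      rw [ht]
      by_cases h' : t ∈ Ioc 0 x <;> simp [h']
    rw [integral_congr_ae e, setIntegral_indicator measurableSet_Ioc,
      inter_eq_right.mpr Ioc_subset_Ioi_self]
  simp_rw [key]
  exact tendsto_const_nhds.inner h

theorem isClosed_H10Half : IsClosed (H10Half 𝕜 : Set (WithLp 2 (L2Half 𝕜 × L2Half 𝕜))) := by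
  refine IsSeqClosed.isClosed fun z z' hz hlim => ?_
  have hz' := fun n => (mem_H10Half_iff (z n)).mp (hz n)
  refine (mem_H10Half_iff z').mpr
    ⟨isClosed_H1Half.isSeqClosed (fun n => (hz' n).1) hlim, ?_⟩
  have l1 : Tendsto (fun n => (z n).fst) atTop (𝓝 z'.fst) :=
    ((WithLp.fstL 2 𝕜 (L2Half 𝕜) (L2Half 𝕜)).continuous.tendsto z').comp hlim
  have l2 : Tendsto (fun n => (z n).snd) atTop (𝓝 z'.snd) :=
    ((WithLp.sndL 2 𝕜 (L2Half 𝕜) (L2Half 𝕜)).continuous.tendsto z').comp hlim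
  obtain ⟨ns, hns, hae⟩ := (tendstoInMeasure_of_tendsto_Lp l1).exists_seq_tendsto_ae
  filter_upwards [hae, ae_all_iff.mpr fun n => (hz' n).2, ae_restrict_mem measurableSet_Ioi]
    with x h1 h2 h3
  have h4 := (tendsto_primitive_L2 l2 (le_of_lt h3)).comp hns.tendsto_atTop
  refine tendsto_nhds_unique h1 (h4.congr fun n => ?_)
  exact (h2 (ns n)).symm

instance : CompleteSpace (H1Half 𝕜) := isClosed_H1Half.completeSpace_coe

instance : CompleteSpace (H10Half 𝕜) := isClosed_H10Half.completeSpace_coe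

variable (𝕜) in
/-- The embedding `H¹(0,∞) ⊆ L²(0,∞)`. -/
def H1ToL2 : H1Half 𝕜 →L[𝕜] L2Half 𝕜 :=
  WithLp.fstL 2 𝕜 (L2Half 𝕜) (L2Half 𝕜) ∘L (H1Half 𝕜).subtypeL

variable (𝕜) in
/-- The embedding `H¹_{0,{0}}(0,∞) ⊆ L²(0,∞)`. -/
def H10ToL2 : H10Half 𝕜 →L[𝕜] L2Half 𝕜 :=
  WithLp.fstL 2 𝕜 (L2Half 𝕜) (L2Half 𝕜) ∘L (H10Half 𝕜).subtypeL

variable (𝕜) in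
/-- `H^{1/2}(0,∞) = [L²(0,∞), H¹(0,∞)]_{1/2}`. -/
abbrev HHalf : Submodule 𝕜 (WithLp 2 (L2Half 𝕜 × L2Half 𝕜)) := interpSpace (H1ToL2 𝕜) (1 / 2)

variable (𝕜) in
/-- The inclusion `H^{1/2}(0,∞) ⊆ L²(0,∞)`. -/
abbrev HHalfToL2 : HHalf 𝕜 →L[𝕜] L2Half 𝕜 := interpIncl (H1ToL2 𝕜) (1 / 2)

variable (𝕜) in
/-- `H^{1/2}_{00,{0}}(0,∞) = [L²(0,∞), H¹_{0,{0}}(0,∞)]_{1/2}`. -/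
abbrev HHalf00 : Submodule 𝕜 (WithLp 2 (L2Half 𝕜 × L2Half 𝕜)) := interpSpace (H10ToL2 𝕜) (1 / 2)

variable (𝕜) in
/-- The inclusion `H^{1/2}_{00,{0}}(0,∞) ⊆ L²(0,∞)`. -/
abbrev HHalf00ToL2 : HHalf00 𝕜 →L[𝕜] L2Half 𝕜 := interpIncl (H10ToL2 𝕜) (1 / 2)

/-- The rescaled collection `{2 ^ (-s |i|) f i}`, for the level function `i ↦ |i| = lev i`. -/
def levelRescale {ι : Type*} (lev : ι → ℕ) (s : ℝ) (f : ι → L2Half 𝕜) (i : ι) : L2Half 𝕜 :=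
  (((2 : ℝ) ^ (-(s * (lev i : ℝ))) : ℝ) : 𝕜) • f i

end HalfLine

end

end HalfLineRiesz

open MeasureTheory Set Filter Topology
open scoped ContDiff

namespace HalfLineRiesz

noncomputable section

/-! ### Algebra, symmetry and continuity of the powers of a positive operator. -/

section PowerCalculus

variable {𝕜 H : Type*} [RCLike 𝕜] [NormedAddCommGroup H] [InnerProductSpace 𝕜 H]

/-! The statement is abstract: it holds for any bounded `j : X → H` between Hilbert spaces under the
stated Riesz basis assumptions, and the half-line enters only through the completeness of the two
Sobolev spaces.

Put T = j j† = Λ⁻², so that T ^ (s/2) = Λ ^ (-s) maps H isomorphically onto [H, X]_s. Let S and S_X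
be the synthesis operators of θ in H and of the renormalized family in X, and let N be the diagonal
operator with entries 1/‖θ_i‖. Then j S_X = S N, and taking adjoints, S_X† j† = N S†. Since ‖T ^
(1/2) h‖ = ‖j† h‖ and N is comparable to D ^ (1/2), with D diagonal with entries 4 ^ (-|i|), the
norms ‖T ^ (1/2) h‖ and ‖D ^ (1/2) S† h‖ are equivalent. So are ‖h‖ and ‖S† h‖, because S is an
isomorphism.

Heinz's inequality (`norm_fracPow_apply_le`) interpolates between these two equivalences: ‖T ^ (s/2)
h‖ and ‖D ^ (s/2) S† h‖ are equivalent for all 0 ≤ s ≤ 1. By duality (`exists_equiv_of_norm_equiv`)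
this yields an isomorphism V with T ^ (s/2) V = S D ^ (s/2). On the unit vector e_i the right side
is 2 ^ (-s|i|) θ_i, so the rescaled family is the image of the standard basis of ℓ² under an
isomorphism onto [H, X]_s.

Heinz's inequality is derived from the operator monotonicity of the square root
(`re_inner_le_of_norm_apply_le`): it gives the midpoint of two exponents, hence all dyadic ones, and
continuity in the exponent gives the rest. -/

/-- It suffices to test the functional calculus on one approximating sequence of polynomials. -/
theorem IsFunctionalCalculus.of_approx {T : H →L[𝕜] H} (hT : T.IsPositive) {f : ℝ → ℝ}
    {B : H →L[𝕜] H}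
    (h : ∀ δ > 0, ∃ p : Polynomial ℝ, (∀ x ∈ Icc (0 : ℝ) ‖T‖, |p.eval x - f x| ≤ δ) ∧
      ‖Polynomial.aeval T (p.map (algebraMap ℝ 𝕜)) - B‖ ≤ δ) :
    IsFunctionalCalculus T f B := by
  intro q ε hq
  refine le_of_forall_pos_le_add fun δ hδ => ?_
  obtain ⟨p, hp, hpB⟩ := h (δ / 2) (half_pos hδ)
  have h1 : ‖Polynomial.aeval T ((q - p).map (algebraMap ℝ 𝕜))‖ ≤ ε + δ / 2 := by
    refine norm_aeval_le_of_isPositive T hT _ _ fun x hx => ?_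
    have h2 := hq x hx
    have h3 := hp x hx
    rw [Polynomial.eval_sub]
    rw [abs_le] at *
    constructor <;> linarith
  rw [Polynomial.map_sub, map_sub] at h1
  calc ‖Polynomial.aeval T (q.map (algebraMap ℝ 𝕜)) - B‖
      ≤ ‖Polynomial.aeval T (q.map (algebraMap ℝ 𝕜))
          - Polynomial.aeval T (p.map (algebraMap ℝ 𝕜))‖
        + ‖Polynomial.aeval T (p.map (algebraMap ℝ 𝕜)) - B‖ := norm_sub_le_norm_sub_add_norm_sub ..
    _ ≤ ε + δ := by linarith

theorem IsFunctionalCalculus.of_polynomial {T : H →L[𝕜] H} (hT : T.IsPositive) {f : ℝ → ℝ}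
    (p : Polynomial ℝ) (hp : ∀ x ∈ Icc (0 : ℝ) ‖T‖, p.eval x = f x) :
    IsFunctionalCalculus T f (Polynomial.aeval T (p.map (algebraMap ℝ 𝕜))) :=
  .of_approx hT fun δ hδ => ⟨p, fun x hx => by simp [hp x hx, hδ.le], by simp [hδ.le]⟩

theorem IsFunctionalCalculus.mul {T : H →L[𝕜] H} (hT : T.IsPositive) {f g : ℝ → ℝ}
    (hf : ContinuousOn f (Icc 0 ‖T‖)) (hg : ContinuousOn g (Icc 0 ‖T‖)) {B C : H →L[𝕜] H}
    (hB : IsFunctionalCalculus T f B) (hC : IsFunctionalCalculus T g C) :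
    IsFunctionalCalculus T (fun x => f x * g x) (B * C) := by
  obtain ⟨M, hM⟩ := isCompact_Icc.exists_bound_of_continuousOn hf
  obtain ⟨N, hN⟩ := isCompact_Icc.exists_bound_of_continuousOn hg
  simp only [Real.norm_eq_abs] at hM hN
  set K : ℝ := |M| + |N| + ‖B‖ + ‖C‖ + 1 with hK
  have hK1 : 1 ≤ K := by
    have := abs_nonneg M; have := abs_nonneg N; have := norm_nonneg B; have := norm_nonneg C
    linarith
  refine .of_approx hT fun δ hδ => ?_
  -- One tolerance serves both product estimates, for the functions and for the operators. The bound
  -- η ≤ 1 makes the quadratic error term linear in η.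
  set η : ℝ := min 1 (δ / (2 * K)) with hη
  have hη0 : 0 < η := lt_min one_pos (by positivity)
  have hη1 : η ≤ 1 := min_le_left _ _
  have hη2 : η * (2 * K) ≤ δ := by
    have := min_le_right 1 (δ / (2 * K))
    rwa [← hη, le_div_iff₀ (by positivity)] at this
  obtain ⟨p, hp⟩ := exists_polynomial_near_of_continuousOn 0 ‖T‖ f hf η hη0
  obtain ⟨q, hq⟩ := exists_polynomial_near_of_continuousOn 0 ‖T‖ g hg η hη0
  refine ⟨p * q, fun x hx => ?_, ?_⟩
  · have h1 := hp x hx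
    have h2 := hq x hx
    have h3 := (hM x hx).trans (le_abs_self M)
    have h4 := (hN x hx).trans (le_abs_self N)
    have e : (p * q).eval x - f x * g x = (p.eval x - f x) * (q.eval x - g x)
        + f x * (q.eval x - g x) + (p.eval x - f x) * g x := by
      rw [Polynomial.eval_mul]; ring
    calc |(p * q).eval x - f x * g x| ≤ |p.eval x - f x| * |q.eval x - g x|
          + |f x| * |q.eval x - g x| + |p.eval x - f x| * |g x| := by
          rw [e, ← abs_mul, ← abs_mul, ← abs_mul]
          exact abs_add_three _ _ _
      _ ≤ η * 1 + |M| * η + η * |N| := by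
          gcongr
          exact h2.le.trans hη1
      _ ≤ η * (2 * K) := by
          have := norm_nonneg B; have := norm_nonneg C; have := abs_nonneg M
          have := abs_nonneg N
          nlinarith
      _ ≤ δ := hη2
  · have h1 := hB p η fun x hx => (hp x hx).le
    have h2 := hC q η fun x hx => (hq x hx).le
    rw [Polynomial.map_mul, map_mul]
    set P := Polynomial.aeval T (p.map (algebraMap ℝ 𝕜))
    set Q := Polynomial.aeval T (q.map (algebraMap ℝ 𝕜))
    have e : P * Q - B * C = (P - B) * (Q - C) + B * (Q - C) + (P - B) * C := by noncomm_ring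
    calc ‖P * Q - B * C‖ ≤ ‖P - B‖ * ‖Q - C‖ + ‖B‖ * ‖Q - C‖ + ‖P - B‖ * ‖C‖ := by
          rw [e]
          refine (norm_add₃_le).trans ?_
          gcongr <;> exact norm_mul_le _ _
      _ ≤ η * 1 + ‖B‖ * η + η * ‖C‖ := by
          gcongr
          exact h2.trans hη1
      _ ≤ η * (2 * K) := by
          have := norm_nonneg B; have := norm_nonneg C; have := abs_nonneg M
          have := abs_nonneg N
          nlinarith
      _ ≤ δ := hη2

theorem isSymmetric_aeval {T : H →L[𝕜] H} (hT : T.IsSymmetric) (p : Polynomial ℝ) (x y : H) :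
    inner 𝕜 (Polynomial.aeval T (p.map (algebraMap ℝ 𝕜)) x) y
      = inner 𝕜 x (Polynomial.aeval T (p.map (algebraMap ℝ 𝕜)) y) := by
  induction p using Polynomial.induction_on' generalizing x y with
  | add p q hp hq =>
    simp only [Polynomial.map_add, map_add, add_apply, inner_add_left, inner_add_right, hp, hq]
  | monomial n a =>
    have hpow : ∀ x y : H, inner 𝕜 ((T ^ n) x) y = inner 𝕜 x ((T ^ n) y) := by
      induction n with
      | zero => simp
      | succ n ih =>
        intro x y
        rw [pow_succ, mul_apply_eq_comp, ih, ← pow_succ, pow_succ', mul_apply_eq_comp]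
        exact hT _ _
    rw [Polynomial.map_monomial, Polynomial.aeval_monomial, ← Algebra.smul_def]
    simp only [smul_apply, inner_smul_left, inner_smul_right, hpow]
    simp

theorem IsFunctionalCalculus.isSymmetric {T : H →L[𝕜] H} (hT : T.IsPositive) {f : ℝ → ℝ}
    (hf : ContinuousOn f (Icc 0 ‖T‖)) {B : H →L[𝕜] H} (hB : IsFunctionalCalculus T f B) (x y : H) :
    inner 𝕜 (B x) y = inner 𝕜 x (B y) := by
  have hpos : ∀ n : ℕ, (0 : ℝ) < 1 / ((n : ℝ) + 1) := fun n => Nat.one_div_pos_of_nat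
  choose P hP using fun n : ℕ =>
    exists_polynomial_near_of_continuousOn 0 ‖T‖ f hf (1 / ((n : ℝ) + 1)) (hpos n)
  have hlim : Tendsto (fun n => Polynomial.aeval T ((P n).map (algebraMap ℝ 𝕜))) atTop (𝓝 B) := by
    rw [tendsto_iff_norm_sub_tendsto_zero]
    exact squeeze_zero (fun _ => norm_nonneg _) (fun n => hB (P n) _ fun x hx => (hP n x hx).le)
      tendsto_one_div_add_atTop_nhds_zero_nat
  have h : ∀ z, Tendsto (fun n => Polynomial.aeval T ((P n).map (algebraMap ℝ 𝕜)) z) atTop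
      (𝓝 (B z)) := fun z => ((ContinuousLinearMap.apply 𝕜 H z).continuous.tendsto B).comp hlim
  refine tendsto_nhds_unique ((h x).inner tendsto_const_nhds)
    ((tendsto_const_nhds.inner (h y)).congr fun n => ?_)
  exact (isSymmetric_aeval hT.isSymmetric (P n) x y).symm

/-- A polynomial within δ/2 of f is within ε + δ/2 of g, so it approximates both operators. This
transfers uniform convergence of functions to operator norm convergence. -/
theorem IsFunctionalCalculus.norm_sub_le {T : H →L[𝕜] H} {f g : ℝ → ℝ}
    (hf : ContinuousOn f (Icc 0 ‖T‖)) {B C : H →L[𝕜] H} (hB : IsFunctionalCalculus T f B)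
    (hC : IsFunctionalCalculus T g C) {ε : ℝ} (h : ∀ x ∈ Icc (0 : ℝ) ‖T‖, |f x - g x| ≤ ε) :
    ‖B - C‖ ≤ ε := by
  refine le_of_forall_pos_le_add fun δ hδ => ?_
  obtain ⟨p, hp⟩ := exists_polynomial_near_of_continuousOn 0 ‖T‖ f hf (δ / 2) (half_pos hδ)
  have h1 := hB p (δ / 2) fun x hx => (hp x hx).le
  have h2 := hC p (ε + δ / 2) fun x hx => by
    have h3 := (hp x hx).le
    have h4 := h x hx
    rw [abs_le] at *
    constructor <;> linarith
  rw [norm_sub_rev] at h1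
  exact (norm_sub_le_norm_sub_add_norm_sub ..).trans (by linarith)

theorem continuousOn_rpow_Icc {r : ℝ} (hr : 0 ≤ r) (M : ℝ) :
    ContinuousOn (fun x : ℝ => x ^ r) (Icc 0 M) :=
  continuousOn_id.rpow_const fun _ _ => Or.inr hr

variable [CompleteSpace H] {T : H →L[𝕜] H}

theorem fracPow_eq (hT : T.IsPositive) {r : ℝ} (hr : 0 ≤ r) {B : H →L[𝕜] H}
    (hB : IsFunctionalCalculus T (fun x => x ^ r) B) : fracPow T r = B :=
  (fracPow_spec T hT r hr).unique (continuousOn_rpow_Icc hr _) hB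

theorem fracPow_zero (hT : T.IsPositive) : fracPow T 0 = 1 := by
  refine fracPow_eq hT le_rfl ?_
  simpa using IsFunctionalCalculus.of_polynomial (𝕜 := 𝕜) (f := fun x => x ^ (0 : ℝ)) hT 1
    (by simp)

theorem fracPow_one (hT : T.IsPositive) : fracPow T 1 = T := by
  refine fracPow_eq hT zero_le_one ?_
  simpa using IsFunctionalCalculus.of_polynomial (𝕜 := 𝕜) (f := fun x => x ^ (1 : ℝ)) hT
    Polynomial.X (by simp)

theorem fracPow_add (hT : T.IsPositive) {r t : ℝ} (hr : 0 ≤ r) (ht : 0 ≤ t) :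
    fracPow T (r + t) = fracPow T r * fracPow T t := by
  refine fracPow_eq hT (add_nonneg hr ht) ?_
  have h := (fracPow_spec T hT r hr).mul hT (continuousOn_rpow_Icc hr _)
    (continuousOn_rpow_Icc ht _) (fracPow_spec T hT t ht)
  intro p ε hp
  refine h p ε fun x hx => ?_
  beta_reduce
  rw [← Real.rpow_add_of_nonneg hx.1 hr ht]
  exact hp x hx

theorem inner_fracPow_left (hT : T.IsPositive) {r : ℝ} (hr : 0 ≤ r) (x y : H) :
    inner 𝕜 (fracPow T r x) y = inner 𝕜 x (fracPow T r y) :=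
  (fracPow_spec T hT r hr).isSymmetric hT (continuousOn_rpow_Icc hr _) x y

theorem inner_fracPow_half_add_half (hT : T.IsPositive) {r : ℝ} (hr : 0 ≤ r) (x y : H) :
    inner 𝕜 (fracPow T r x) y = inner 𝕜 (fracPow T (r / 2) x) (fracPow T (r / 2) y) := by
  have h2 : 0 ≤ r / 2 := by positivity
  conv_lhs => rw [← add_halves r, fracPow_add hT h2 h2, mul_apply_eq_comp, inner_fracPow_left hT h2]

theorem isPositive_fracPow (hT : T.IsPositive) {r : ℝ} (hr : 0 ≤ r) :
    (fracPow T r).IsPositive := by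
  refine ⟨fun x y => inner_fracPow_left hT hr x y, fun x => ?_⟩
  rw [ContinuousLinearMap.reApplyInnerSelf, inner_fracPow_half_add_half hT hr]
  exact inner_self_nonneg

/-- The map (t, x) ↦ x ^ t is jointly continuous for t > 0 and x in the compact interval [0, ‖T‖],
hence uniformly convergent in x. At r = 0 this breaks down, because 0 ^ t jumps there. -/
theorem tendsto_fracPow (hT : T.IsPositive) {r : ℝ} (hr : 0 < r) :
    Tendsto (fracPow T) (𝓝 r) (𝓝 (fracPow T r)) := by
  have hU : TendstoUniformly (fun (t : ℝ) (x : Icc (0 : ℝ) ‖T‖) => (x : ℝ) ^ t)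
      (fun x => (x : ℝ) ^ r) (𝓝 r) := by
    refine ContinuousOn.tendstoUniformly (f := fun (t : ℝ) (x : Icc (0 : ℝ) ‖T‖) => (x : ℝ) ^ t)
      (Ioi_mem_nhds hr) ?_
    refine ContinuousOn.rpow (by fun_prop) (by fun_prop) fun z hz => Or.inr hz.1
  rw [Metric.tendsto_nhds]
  intro ε hε
  filter_upwards [Metric.tendstoUniformly_iff.mp hU (ε / 2) (half_pos hε), Ioi_mem_nhds hr]
    with t ht ht0
  rw [dist_eq_norm]
  refine lt_of_le_of_lt (IsFunctionalCalculus.norm_sub_le (continuousOn_rpow_Icc (le_of_lt ht0) _)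
    (fracPow_spec T hT t (le_of_lt ht0)) (fracPow_spec T hT r hr.le) (ε := ε / 2) fun x hx => ?_)
    (half_lt_self hε)
  have := ht ⟨x, hx⟩
  rw [dist_comm, Real.dist_eq] at this
  exact this.le

theorem fracPow_injective (hT : T.IsPositive) (hi : Function.Injective T) {r : ℝ}
    (hr : r ∈ Icc (0 : ℝ) 1) : Function.Injective (fracPow T r) := by
  intro x y h
  apply hi
  have e : T = fracPow T (1 - r) * fracPow T r := by
    rw [← fracPow_add hT (sub_nonneg.mpr hr.2) hr.1, sub_add_cancel, fracPow_one hT]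
  rw [e, mul_apply_eq_comp, mul_apply_eq_comp, h]

theorem denseRange_of_isSymmetric_of_injective {A : H →L[𝕜] H} (hA : A.IsSymmetric)
    (hi : Function.Injective A) : DenseRange A := by
  have h : (LinearMap.range (A : H →ₗ[𝕜] H))ᗮ = ⊥ := by
    rw [Submodule.eq_bot_iff]
    intro x hx
    apply hi
    rw [map_zero, ← inner_self_eq_zero (𝕜 := 𝕜)]
    -- A vector x orthogonal to the range is tested against A (A x), which gives ‖A x‖² = 0.
    have := (Submodule.mem_orthogonal _ _).mp hx (A (A x)) ⟨A x, rfl⟩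
    exact (hA (A x) x).symm.trans this
  have h' := (Submodule.topologicalClosure_eq_top_iff).mpr h
  rw [DenseRange, dense_iff_closure_eq]
  exact congrArg (fun V : Submodule 𝕜 H => (V : Set H)) h'

theorem denseRange_fracPow (hT : T.IsPositive) (hi : Function.Injective T) {r : ℝ}
    (hr : r ∈ Icc (0 : ℝ) 1) : DenseRange (fracPow T r) :=
  denseRange_of_isSymmetric_of_injective (isPositive_fracPow hT hr.1).isSymmetric
    (fracPow_injective hT hi hr)

end PowerCalculus

/-! ### Operator monotonicity of the square root and Heinz's inequality. -/

section Heinz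

variable {𝕜 H K : Type*} [RCLike 𝕜]
  [NormedAddCommGroup H] [InnerProductSpace 𝕜 H]
  [NormedAddCommGroup K] [InnerProductSpace 𝕜 K]

/-- Positivity of U is tested on C x - U x with C = ‖U‖ + 1; the summand 1 keeps C positive for the
final division. It follows that a nearly minimizing vector of the form of U is nearly annihilated by
U. -/
theorem norm_sq_apply_le_of_isPositive {U : H →L[𝕜] H} (hU : U.IsPositive) (x : H) :
    ‖U x‖ ^ 2 ≤ (‖U‖ + 1) * RCLike.re (inner 𝕜 (U x) x) := by
  set C : ℝ := ‖U‖ + 1 with hC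
  have hC0 : 0 < C := by positivity
  have h := hU.re_inner_nonneg_left (((C : ℝ) : 𝕜) • x - U x)
  have h1 : RCLike.re (inner 𝕜 (U (U x)) (U x)) ≤ ‖U‖ * ‖U x‖ ^ 2 := by
    refine (RCLike.re_le_norm _).trans ((norm_inner_le_norm _ _).trans ?_)
    rw [sq, ← mul_assoc]
    gcongr
    exact U.le_opNorm _
  have h2 : RCLike.re (inner 𝕜 (U x) (U x)) = ‖U x‖ ^ 2 := inner_self_eq_norm_sq _
  have h3 : RCLike.re (inner 𝕜 (U (U x)) x) = ‖U x‖ ^ 2 := by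
    rw [hU.inner_left_eq_inner_right, h2]
  simp only [map_sub, map_smul, inner_sub_left, inner_sub_right, inner_smul_left, inner_smul_right,
    RCLike.conj_ofReal, RCLike.re_ofReal_mul, h2, h3] at h
  have h4 : C * ‖U x‖ ^ 2 ≤ C * (C * RCLike.re (inner 𝕜 (U x) x)) := by
    have e : ‖U‖ = C - 1 := by rw [hC]; ring
    rw [e] at h1
    nlinarith [sq_nonneg ‖U x‖]
  exact le_of_mul_le_mul_left h4 hC0

/-- The square root is operator monotone: `Z² ≤ A²` implies `Z ≤ A`, for positive `A`, `Z`. -/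
theorem re_inner_le_of_norm_apply_le {A Z : H →L[𝕜] H} (hA : A.IsPositive) (hZ : Z.IsPositive)
    (h : ∀ x, ‖Z x‖ ≤ ‖A x‖) (x : H) :
    RCLike.re (inner 𝕜 (Z x) x) ≤ RCLike.re (inner 𝕜 (A x) x) := by
  -- If the claim fails, the infimum m of the form of W = A - Z on unit vectors is negative. As m
  -- need not be an eigenvalue, the argument uses unit vectors y with U y = W y - m y small.
  by_contra! hx
  set W : H →L[𝕜] H := A - Z with hW
  have hWx : ∀ y, RCLike.re (inner 𝕜 (W y) y)
      = RCLike.re (inner 𝕜 (A y) y) - RCLike.re (inner 𝕜 (Z y) y) := by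
    intro y
    rw [hW, sub_apply, inner_sub_left, map_sub]
  set S : Set ℝ := {t | ∃ y, ‖y‖ = 1 ∧ RCLike.re (inner 𝕜 (W y) y) = t} with hS
  have hlow : BddBelow S := by
    refine ⟨-‖W‖, ?_⟩
    rintro _ ⟨y, hy, rfl⟩
    have := (RCLike.abs_re_le_norm (inner 𝕜 (W y) y)).trans (norm_inner_le_norm _ _)
    have h2 := W.le_opNorm y
    rw [hy] at this h2
    rw [mul_one] at this h2
    exact (abs_le.mp (this.trans h2)).1
  have hscale : ∀ y, y ≠ 0 → RCLike.re (inner 𝕜 (W y) y) / ‖y‖ ^ 2 ∈ S := by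
    intro y hy
    have hy' : ‖y‖ ≠ 0 := norm_ne_zero_iff.mpr hy
    refine ⟨((‖y‖⁻¹ : ℝ) : 𝕜) • y, ?_, ?_⟩
    · rw [norm_smul, RCLike.norm_ofReal, abs_of_nonneg (by positivity), inv_mul_cancel₀ hy']
    · rw [map_smul, inner_smul_left, inner_smul_right, RCLike.conj_ofReal, RCLike.re_ofReal_mul,
        RCLike.re_ofReal_mul]
      field_simp
  have hx0 : x ≠ 0 := by
    rintro rfl
    simp at hx
  set m := sInf S with hm
  have hm0 : m < 0 := by
    refine (csInf_le hlow (hscale x hx0)).trans_lt (div_neg_of_neg_of_pos ?_ (by positivity))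
    rw [hWx]
    linarith
  set U : H →L[𝕜] H := W - ((m : ℝ) : 𝕜) • 1 with hUdef
  have hUx : ∀ y, U y = W y - ((m : ℝ) : 𝕜) • y := fun y => by simp [hUdef]
  have hUre : ∀ y, RCLike.re (inner 𝕜 (U y) y) = RCLike.re (inner 𝕜 (W y) y) - m * ‖y‖ ^ 2 := by
    intro y
    rw [hUx, inner_sub_left, map_sub, inner_smul_left, RCLike.conj_ofReal, RCLike.re_ofReal_mul,
      inner_self_eq_norm_sq]
  have hU : U.IsPositive := by
    refine ⟨fun y z => ?_, fun y => ?_⟩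
    · have hA' := hA.inner_left_eq_inner_right y z
      have hZ' := hZ.inner_left_eq_inner_right y z
      change inner 𝕜 (U y) z = inner 𝕜 y (U z)
      rw [hUx, hUx, hW, sub_apply, sub_apply]
      simp only [inner_sub_left, inner_sub_right, inner_smul_left, inner_smul_right,
        RCLike.conj_ofReal, hA', hZ']
    · rw [ContinuousLinearMap.reApplyInnerSelf, hUre]
      by_cases hy : y = 0
      · simp [hy]
      have := csInf_le hlow (hscale y hy)
      rw [le_div_iff₀ (by positivity)] at this
      linarith
  set C : ℝ := ‖A + Z‖ with hC
  have key : ∀ δ > 0, ∃ y, ‖y‖ = 1 ∧ RCLike.re (inner 𝕜 (U y) y) < δ := by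
    intro δ hδ
    obtain ⟨_, ⟨y, hy, rfl⟩, hlt⟩ := exists_lt_of_csInf_lt ⟨_, hscale x hx0⟩
      (show sInf S < m + δ by rw [← hm]; linarith)
    refine ⟨y, hy, ?_⟩
    rw [hUre, hy]
    linarith
  -- The real part of ⟪(A + Z) y, W y⟫ is ‖A y‖² - ‖Z y‖² ≥ 0. Replacing W y by m y + U y, and using
  -- that the form of A + Z dominates that of -W because A ≥ 0, bounds roughly m² by C ‖U y‖.
  have est : ∀ y, ‖y‖ = 1 →
      -m * (-m - RCLike.re (inner 𝕜 (U y) y)) ≤ C * ‖U y‖ := by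
    intro y hy
    have h1 : RCLike.re (inner 𝕜 ((A + Z) y) (W y)) = ‖A y‖ ^ 2 - ‖Z y‖ ^ 2 := by
      rw [hW, add_apply, sub_apply]
      simp only [inner_add_left, inner_sub_right, map_add, map_sub, inner_self_eq_norm_sq]
      rw [inner_re_symm (𝕜 := 𝕜) (A y) (Z y)]
      ring
    have h2 : 0 ≤ RCLike.re (inner 𝕜 ((A + Z) y) (W y)) := by
      rw [h1, sub_nonneg]
      gcongr
      exact h y
    have h3 : RCLike.re (inner 𝕜 ((A + Z) y) (U y)) ≤ C * ‖U y‖ := by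
      refine (RCLike.re_le_norm _).trans ((norm_inner_le_norm _ _).trans ?_)
      gcongr
      simpa [hy] using (A + Z).le_opNorm y
    rw [hUx y, inner_sub_right, map_sub, inner_smul_right, RCLike.re_ofReal_mul] at h3
    have h6 : RCLike.re (inner 𝕜 ((A + Z) y) y)
        = RCLike.re (inner 𝕜 (A y) y) + RCLike.re (inner 𝕜 (Z y) y) := by
      rw [add_apply, inner_add_left, map_add]
    rw [h6, ← hUx y] at h3
    have h4 := hA.re_inner_nonneg_left y
    have h5 := hUre y
    rw [hWx, hy] at h5
    nlinarith
  set R : ℝ := C ^ 2 * (‖U‖ + 1) + 1 with hR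
  have hR0 : 0 < R := by positivity
  -- The first bound on d turns `est` into m²/2 ≤ C ‖U y‖. Squaring gives m⁴/4 ≤ R d, which the
  -- second bound contradicts.
  obtain ⟨y, hy, hlt⟩ := key (min (-m / 2) (m ^ 4 / (4 * R))) (by
    have := hm0.ne
    exact lt_min (by linarith) (by positivity))
  have hpos := hU.re_inner_nonneg_left y
  set d := RCLike.re (inner 𝕜 (U y) y) with hd
  have hd1 : d < -m / 2 := hlt.trans_le (min_le_left _ _)
  have hd2 : d * (4 * R) < m ^ 4 := by
    have := hlt.trans_le (min_le_right _ _)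
    rwa [lt_div_iff₀ (by positivity)] at this
  have h6 : m ^ 2 / 2 ≤ C * ‖U y‖ := by nlinarith [est y hy]
  have h7 : (m ^ 2 / 2) ^ 2 ≤ (C * ‖U y‖) ^ 2 := by gcongr
  have h8 : (C * ‖U y‖) ^ 2 ≤ R * d := by
    rw [mul_pow]
    have := mul_le_mul_of_nonneg_left (norm_sq_apply_le_of_isPositive hU y) (sq_nonneg C)
    rw [← hd] at this
    rw [hR]
    nlinarith
  nlinarith

variable [CompleteSpace H] [CompleteSpace K]

/-- Operator monotonicity of the square root is applied to Z = Q† B ^ r Q and A' = M² A ^ r. Both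
hypotheses enter the bound ‖Z y‖ ≤ ‖A' y‖, each contributing one factor M. -/
theorem norm_fracPow_half_apply_le {A : H →L[𝕜] H} {B : K →L[𝕜] K} (hA : A.IsPositive)
    (hB : B.IsPositive) {Q : H →L[𝕜] K} {M r : ℝ} (hM : 0 ≤ M) (hr : 0 ≤ r)
    (hQ : ∀ x, ‖Q x‖ ≤ M * ‖x‖) (h : ∀ x, ‖fracPow B r (Q x)‖ ≤ M * ‖fracPow A r x‖) (x : H) :
    ‖fracPow B (r / 2) (Q x)‖ ≤ M * ‖fracPow A (r / 2) x‖ := by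
  obtain ⟨Z, hZpos, hZ⟩ : ∃ Z : H →L[𝕜] H, Z.IsPositive ∧
      ∀ y, Z y = ContinuousLinearMap.adjoint Q (fracPow B r (Q y)) :=
    ⟨_, (isPositive_fracPow hB hr).adjoint_conj Q, fun _ => rfl⟩
  obtain ⟨A', hA'⟩ : ∃ A' : H →L[𝕜] H, A' = ((M ^ 2 : ℝ) : 𝕜) • fracPow A r := ⟨_, rfl⟩
  have hA'x : ∀ y, RCLike.re (inner 𝕜 (A' y) y) = M ^ 2 * RCLike.re (inner 𝕜 (fracPow A r y) y) := by
    intro y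
    rw [hA', smul_apply, inner_smul_left, RCLike.conj_ofReal, RCLike.re_ofReal_mul]
  have hpos := isPositive_fracPow hA hr
  have hA'pos : A'.IsPositive := by
    refine ⟨fun y z => ?_, fun y => ?_⟩
    · change inner 𝕜 (A' y) z = inner 𝕜 y (A' z)
      rw [hA', smul_apply, smul_apply, inner_smul_left, inner_smul_right, RCLike.conj_ofReal,
        hpos.inner_left_eq_inner_right]
    · rw [ContinuousLinearMap.reApplyInnerSelf, hA'x]
      exact mul_nonneg (sq_nonneg M) (hpos.re_inner_nonneg_left y)
  have hQn : ‖ContinuousLinearMap.adjoint Q‖ ≤ M := by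
    rw [LinearIsometryEquiv.norm_map]
    exact Q.opNorm_le_bound hM hQ
  have hle : ∀ y, ‖Z y‖ ≤ ‖A' y‖ := by
    intro y
    calc ‖Z y‖ ≤ ‖ContinuousLinearMap.adjoint Q‖ * ‖fracPow B r (Q y)‖ := by
          rw [hZ]
          exact ContinuousLinearMap.le_opNorm _ _
      _ ≤ M * (M * ‖fracPow A r y‖) := by gcongr; exact h y
      _ = ‖A' y‖ := by
          rw [hA', smul_apply, norm_smul, RCLike.norm_ofReal, abs_of_nonneg (sq_nonneg M)]
          ring
  have := re_inner_le_of_norm_apply_le hA'pos hZpos hle x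
  rw [hA'x, inner_fracPow_half_add_half hA hr, inner_self_eq_norm_sq] at this
  have e : inner 𝕜 (Z x) x = inner 𝕜 (fracPow B (r / 2) (Q x)) (fracPow B (r / 2) (Q x)) := by
    rw [← inner_fracPow_half_add_half hB hr, hZ, ContinuousLinearMap.adjoint_inner_left]
  rw [e, inner_self_eq_norm_sq, ← mul_pow] at this
  exact le_of_sq_le_sq this (by positivity)

/-- The bound at exponent a says that A ^ a x ↦ B ^ a Q x is bounded by M on a dense range, so it
extends to an operator Y. The bound at b then becomes the hypothesis of `norm_fracPow_half_apply_le`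
for Y with exponent b - a. -/
theorem norm_fracPow_midpoint_apply_le {A : H →L[𝕜] H} {B : K →L[𝕜] K} (hA : A.IsPositive)
    (hAi : Function.Injective A) (hB : B.IsPositive) {Q : H →L[𝕜] K} {M a b : ℝ} (hM : 0 ≤ M)
    (ha : 0 ≤ a) (hab : a ≤ b) (hb : b ≤ 1)
    (h1 : ∀ x, ‖fracPow B a (Q x)‖ ≤ M * ‖fracPow A a x‖)
    (h2 : ∀ x, ‖fracPow B b (Q x)‖ ≤ M * ‖fracPow A b x‖) (x : H) :
    ‖fracPow B ((a + b) / 2) (Q x)‖ ≤ M * ‖fracPow A ((a + b) / 2) x‖ := by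
  have hd : DenseRange (fracPow A a) := denseRange_fracPow hA hAi ⟨ha, hab.trans hb⟩
  let Y : H →L[𝕜] K := ((fracPow B a ∘L Q : H →L[𝕜] K) : H →ₗ[𝕜] K).extendOfNorm
    (fracPow A a : H →ₗ[𝕜] H)
  have hY : ∀ y, Y (fracPow A a y) = fracPow B a (Q y) := fun y =>
    LinearMap.extendOfNorm_eq (f := ((fracPow B a ∘L Q : H →L[𝕜] K) : H →ₗ[𝕜] K))
      (e := (fracPow A a : H →ₗ[𝕜] H)) hd ⟨M, h1⟩ y
  have hYn : ∀ y, ‖Y y‖ ≤ M * ‖y‖ := fun y =>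
    LinearMap.norm_extendOfNorm_apply_le (f := ((fracPow B a ∘L Q : H →L[𝕜] K) : H →ₗ[𝕜] K))
      (e := (fracPow A a : H →ₗ[𝕜] H)) hd M h1 y
  have hc : 0 ≤ b - a := sub_nonneg.mpr hab
  have hYc : ∀ y, ‖fracPow B (b - a) (Y y)‖ ≤ M * ‖fracPow A (b - a) y‖ := by
    intro y
    refine hd.induction_on y (isClosed_le (by fun_prop) (by fun_prop)) fun z => ?_
    rw [hY, ← mul_apply_eq_comp, ← mul_apply_eq_comp, ← fracPow_add hB hc ha, ← fracPow_add hA hc ha,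
      sub_add_cancel]
    exact h2 z
  have := norm_fracPow_half_apply_le hA hB hM hc hYn hYc (fracPow A a x)
  have hc2 : 0 ≤ (b - a) / 2 := by positivity
  rw [hY, ← mul_apply_eq_comp, ← mul_apply_eq_comp, ← fracPow_add hB hc2 ha, ← fracPow_add hA hc2 ha]
    at this
  have e : (b - a) / 2 + a = (a + b) / 2 := by ring
  rwa [e] at this

/-- Interpolation of operator bounds between powers of positive operators (Heinz's inequality). -/
theorem norm_fracPow_apply_le {A : H →L[𝕜] H} {B : K →L[𝕜] K} (hA : A.IsPositive)
    (hAi : Function.Injective A) (hB : B.IsPositive) {Q : H →L[𝕜] K} {M b : ℝ} (hM : 0 ≤ M)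
    (hb0 : 0 ≤ b) (hb : b ≤ 1) (hQ : ∀ x, ‖Q x‖ ≤ M * ‖x‖)
    (h : ∀ x, ‖fracPow B b (Q x)‖ ≤ M * ‖fracPow A b x‖) {t : ℝ} (ht : t ∈ Icc (0 : ℝ) 1) (x : H) :
    ‖fracPow B (t * b) (Q x)‖ ≤ M * ‖fracPow A (t * b) x‖ := by
  have h0 : ∀ x, ‖fracPow B 0 (Q x)‖ ≤ M * ‖fracPow A 0 x‖ := by
    intro x
    rw [fracPow_zero hA, fracPow_zero hB]
    exact hQ x
  have hdy : ∀ n k : ℕ, k ≤ 2 ^ n → ∀ x,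
      ‖fracPow B ((k : ℝ) / 2 ^ n * b) (Q x)‖ ≤ M * ‖fracPow A ((k : ℝ) / 2 ^ n * b) x‖ := by
    intro n
    induction n with
    | zero =>
      intro k hk
      have : k = 0 ∨ k = 1 := by rw [pow_zero] at hk; omega
      rcases this with rfl | rfl
      · simpa using h0
      · simpa using h
    | succ n ih =>
      intro k hk
      rw [pow_succ] at hk
      -- k is the sum of the floor and the ceiling of k/2, so each new dyadic point is the midpoint
      -- of two points of the previous level, which coincide when k is even.
      have hmid : (k : ℝ) / 2 ^ (n + 1) * b
          = (((k / 2 : ℕ) : ℝ) / 2 ^ n * b + (((k + 1) / 2 : ℕ) : ℝ) / 2 ^ n * b) / 2 := by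
        have e : (k : ℝ) = ((k / 2 : ℕ) : ℝ) + (((k + 1) / 2 : ℕ) : ℝ) := by
          rw [← Nat.cast_add]
          congr 1
          omega
        rw [e, pow_succ]
        field_simp
      rw [hmid]
      refine norm_fracPow_midpoint_apply_le hA hAi hB hM (by positivity) ?_ ?_
        (ih (k / 2) (by omega)) (ih ((k + 1) / 2) (by omega))
      · gcongr
        omega
      · refine mul_le_one₀ ?_ hb0 hb
        rw [div_le_one (by positivity)]
        exact_mod_cast (show (k + 1) / 2 ≤ 2 ^ n by omega)
  -- Exponent 0 is treated apart, since the powers are norm continuous only at positive exponents.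
  rcases eq_or_lt_of_le (mul_nonneg ht.1 hb0) with htb | htb
  · rw [← htb]
    exact h0 x
  have hlim : Tendsto (fun n : ℕ => ((⌊t * 2 ^ n⌋₊ : ℕ) : ℝ) / 2 ^ n * b) atTop (𝓝 (t * b)) := by
    refine Tendsto.mul_const b ?_
    exact (tendsto_nat_floor_mul_div_atTop (R := ℝ) ht.1).comp
      (tendsto_pow_atTop_atTop_of_one_lt (one_lt_two (α := ℝ)))
  have hBl := (((ContinuousLinearMap.apply 𝕜 K (Q x)).continuous.tendsto _).comp
    ((tendsto_fracPow hB htb).comp hlim)).norm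
  have hAl := (((ContinuousLinearMap.apply 𝕜 H x).continuous.tendsto _).comp
    ((tendsto_fracPow hA htb).comp hlim)).norm.const_mul M
  refine le_of_tendsto_of_tendsto' hBl hAl fun n => hdy n _ ?_ x
  have : t * 2 ^ n ≤ ((2 ^ n : ℕ) : ℝ) := by
    push_cast
    exact mul_le_of_le_one_left (by positivity) ht.2
  exact Nat.floor_le_of_le this

end Heinz

/-! ### Diagonal operators on ℓ² and their powers. -/

section Diagonal

variable {𝕜 ι : Type*} [RCLike 𝕜]

/-- `D` is the diagonal operator on `ℓ²(ι)` with real diagonal entries `d`. -/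
def IsDiag (D : lp (fun _ : ι => 𝕜) 2 →L[𝕜] lp (fun _ : ι => 𝕜) 2) (d : ι → ℝ) : Prop :=
  ∀ c i, D c i = (d i : 𝕜) * c i

theorem exists_isDiag (𝕜 : Type*) [RCLike 𝕜] {d : ι → ℝ} {K : ℝ} (hd : ∀ i, |d i| ≤ K) :
    ∃ D : lp (fun _ : ι => 𝕜) 2 →L[𝕜] lp (fun _ : ι => 𝕜) 2, IsDiag D d :=
  ⟨lp.mapCLM 2 (fun i => (d i : 𝕜) • ContinuousLinearMap.id 𝕜 𝕜) (abs_nonneg K) fun i => by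
    refine (norm_smul_le _ _).trans ?_
    rw [RCLike.norm_ofReal]
    exact (mul_le_of_le_one_right (abs_nonneg _) ContinuousLinearMap.norm_id_le).trans
      ((hd i).trans (le_abs_self K)), fun c i => by simp [lp.mapCLM]⟩

variable {D E : lp (fun _ : ι => 𝕜) 2 →L[𝕜] lp (fun _ : ι => 𝕜) 2} {d e : ι → ℝ}

theorem IsDiag.norm_apply_le (hD : IsDiag D d) (hE : IsDiag E e) {K : ℝ} (hK : 0 ≤ K)
    (h : ∀ i, |d i| ≤ K * |e i|) (c : lp (fun _ : ι => 𝕜) 2) : ‖D c‖ ≤ K * ‖E c‖ := by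
  have : K * ‖E c‖ = ‖((K : ℝ) : 𝕜) • E c‖ := by
    rw [norm_smul, RCLike.norm_ofReal, abs_of_nonneg hK]
  rw [this]
  refine lp.norm_mono two_ne_zero fun i => ?_
  rw [lp.coeFn_smul, Pi.smul_apply, hD, hE, norm_smul, norm_mul, norm_mul, RCLike.norm_ofReal,
    RCLike.norm_ofReal, RCLike.norm_ofReal, abs_of_nonneg hK, ← mul_assoc]
  gcongr
  exact h i

theorem isDiag_one : IsDiag (1 : lp (fun _ : ι => 𝕜) 2 →L[𝕜] lp (fun _ : ι => 𝕜) 2)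
    (fun _ => 1) := fun c i => by simp

theorem IsDiag.norm_le (hD : IsDiag D d) {K : ℝ} (hK : 0 ≤ K) (h : ∀ i, |d i| ≤ K) : ‖D‖ ≤ K :=
  D.opNorm_le_bound hK fun c =>
    hD.norm_apply_le isDiag_one hK (fun i => by simpa using h i) c

theorem IsDiag.abs_le_norm (hD : IsDiag D d) (i : ι) : |d i| ≤ ‖D‖ := by
  classical
  have h1 := D.le_opNorm (lp.single 2 i (1 : 𝕜))
  have h2 := lp.norm_apply_le_norm two_ne_zero (D (lp.single 2 i (1 : 𝕜))) i
  rw [hD, lp.single_apply_self, mul_one, RCLike.norm_ofReal] at h2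
  rw [lp.norm_single two_pos, norm_one, mul_one] at h1
  exact h2.trans h1

theorem IsDiag.sub (hD : IsDiag D d) (hE : IsDiag E e) : IsDiag (D - E) (fun i => d i - e i) := by
  intro c i
  rw [sub_apply, lp.coeFn_sub, Pi.sub_apply, hD, hE, RCLike.ofReal_sub, sub_mul]

theorem IsDiag.aeval (hD : IsDiag D d) (p : Polynomial ℝ) :
    IsDiag (Polynomial.aeval D (p.map (algebraMap ℝ 𝕜))) (fun i => p.eval (d i)) := by
  induction p using Polynomial.induction_on' with
  | add p q hp hq =>
    intro c i
    rw [Polynomial.map_add, map_add, add_apply, lp.coeFn_add, Pi.add_apply, hp, hq]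
    beta_reduce
    rw [Polynomial.eval_add, RCLike.ofReal_add, add_mul]
  | monomial n a =>
    have hpow : IsDiag (D ^ n) fun i => d i ^ n := by
      induction n with
      | zero => simpa using isDiag_one
      | succ n ih =>
        intro c i
        rw [pow_succ', mul_apply_eq_comp, hD, ih]
        beta_reduce
        rw [pow_succ', RCLike.ofReal_mul, mul_assoc]
    intro c i
    rw [Polynomial.map_monomial, Polynomial.aeval_monomial, ← Algebra.smul_def, smul_apply,
      lp.coeFn_smul, Pi.smul_apply, hpow]
    beta_reduce
    rw [Polynomial.eval_monomial, RCLike.ofReal_mul, smul_eq_mul, mul_assoc]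

theorem IsDiag.inner_left (hD : IsDiag D d) (x y : lp (fun _ : ι => 𝕜) 2) :
    inner 𝕜 (D x) y = inner 𝕜 x (D y) := by
  rw [lp.inner_eq_tsum, lp.inner_eq_tsum]
  refine tsum_congr fun i => ?_
  rw [hD, hD]
  simp only [RCLike.inner_apply, map_mul, RCLike.conj_ofReal]
  ring

theorem IsDiag.isPositive (hD : IsDiag D d) (hd : ∀ i, 0 ≤ d i) : D.IsPositive := by
  refine ⟨hD.inner_left, fun x => ?_⟩
  rw [ContinuousLinearMap.reApplyInnerSelf]
  refine (RCLike.hasSum_re 𝕜 (lp.hasSum_inner (𝕜 := 𝕜) (D x) x)).nonneg fun i => ?_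
  rw [hD, ← smul_eq_mul, inner_smul_left, RCLike.conj_ofReal, RCLike.re_ofReal_mul]
  exact mul_nonneg (hd i) inner_self_nonneg

theorem IsDiag.injective (hD : IsDiag D d) (hd : ∀ i, d i ≠ 0) : Function.Injective D := by
  intro x y h
  ext i
  have := congrArg (fun z : lp (fun _ : ι => 𝕜) 2 => z i) h
  simp only [hD x i, hD y i] at this
  exact mul_left_cancel₀ (RCLike.ofReal_ne_zero.mpr (hd i)) this

theorem IsDiag.fracPow (hD : IsDiag D d) (hd : ∀ i, 0 ≤ d i) {r : ℝ} (hr : 0 ≤ r) :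
    IsDiag (fracPow D r) (fun i => d i ^ r) := by
  obtain ⟨E, hE⟩ := exists_isDiag 𝕜 (d := fun i => d i ^ r) (K := ‖D‖ ^ r) fun i => by
    rw [abs_of_nonneg (Real.rpow_nonneg (hd i) r)]
    exact Real.rpow_le_rpow (hd i) ((le_abs_self _).trans (hD.abs_le_norm i)) hr
  rw [fracPow_eq (hD.isPositive hd) hr (B := E)]
  · exact hE
  -- The operator p(D) - E is diagonal with entries p(d i) - d i ^ r, and each d i lies in [0, ‖D‖].
  · intro p ε hp
    refine ((hD.aeval p).sub hE).norm_le ((abs_nonneg _).trans (hp 0 ⟨le_rfl, norm_nonneg D⟩))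
      fun i => hp _ ⟨hd i, (le_abs_self _).trans (hD.abs_le_norm i)⟩

end Diagonal

/-! ### Duality and Riesz bases of abstract interpolation spaces. -/

section Interpolation

variable {𝕜 H K X : Type*} [RCLike 𝕜]
  [NormedAddCommGroup H] [InnerProductSpace 𝕜 H] [CompleteSpace H]
  [NormedAddCommGroup K] [InnerProductSpace 𝕜 K] [CompleteSpace K]
  [NormedAddCommGroup X] [InnerProductSpace 𝕜 X] [CompleteSpace X]

theorem adjoint_adjoint_symm_apply (V : H ≃L[𝕜] K) (x : H) :
    ContinuousLinearMap.adjoint (V : H →L[𝕜] K)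
      (ContinuousLinearMap.adjoint (V.symm : K →L[𝕜] H) x) = x := by
  refine ext_inner_right 𝕜 fun y => ?_
  rw [ContinuousLinearMap.adjoint_inner_left, ContinuousLinearMap.adjoint_inner_left]
  simp

/-- The adjoint of a bounded linear isomorphism. -/
def adjointEquiv (V : H ≃L[𝕜] K) : K ≃L[𝕜] H :=
  ContinuousLinearEquiv.equivOfInverse (ContinuousLinearMap.adjoint (V : H →L[𝕜] K))
    (ContinuousLinearMap.adjoint (V.symm : K →L[𝕜] H)) (adjoint_adjoint_symm_apply V.symm)
    (adjoint_adjoint_symm_apply V)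

theorem inner_adjointEquiv_left (V : H ≃L[𝕜] K) (x : K) (y : H) :
    inner 𝕜 (adjointEquiv V x) y = inner 𝕜 x (V y) :=
  ContinuousLinearMap.adjoint_inner_left (V : H →L[𝕜] K) y x

/-- `Λ ^ (-s)` as an isomorphism from `H` onto `[H, X]_s`. -/
def interpEquiv (j : X →L[𝕜] H) (s : ℝ) : H ≃L[𝕜] interpSpace j s :=
  ContinuousLinearEquiv.equivOfInverse
    (ContinuousLinearMap.codRestrict
      (((WithLp.prodContinuousLinearEquiv 2 𝕜 H H).symm : H × H →L[𝕜] WithLp 2 (H × H)) ∘L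
        (fracPow (invSqOp j) (s / 2)).prod (ContinuousLinearMap.id 𝕜 H))
      (interpSpace j s) fun _ => rfl)
    (WithLp.sndL 2 𝕜 H H ∘L (interpSpace j s).subtypeL) (fun _ => rfl) (by
      rintro ⟨z, hz⟩
      have hz : z.fst = fracPow (invSqOp j) (s / 2) z.snd := hz
      apply Subtype.ext
      change WithLp.toLp 2 (fracPow (invSqOp j) (s / 2) z.snd, z.snd) = z
      rw [← hz]
      rfl)

theorem interpIncl_interpEquiv (j : X →L[𝕜] H) (s : ℝ) (v : H) :
    interpIncl j s (interpEquiv j s v) = fracPow (invSqOp j) (s / 2) v := rfl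

/-- Both squared norms equal ⟪j j† h, h⟫. This links the endpoint s = 1 to the space X. -/
theorem norm_fracPow_invSqOp_half (j : X →L[𝕜] H) (h : H) :
    ‖fracPow (invSqOp j) (1 / 2) h‖ = ‖ContinuousLinearMap.adjoint j h‖ := by
  have e := inner_fracPow_half_add_half (isPositive_invSqOp j) zero_le_one h h
  rw [fracPow_one (isPositive_invSqOp j), invSqOp, ContinuousLinearMap.comp_apply,
    ← ContinuousLinearMap.adjoint_inner_right] at e
  have e' := congrArg RCLike.re e
  rw [inner_self_eq_norm_sq, inner_self_eq_norm_sq] at e'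
  exact ((sq_eq_sq₀ (norm_nonneg _) (norm_nonneg _)).mp e').symm

/-- If `‖Λ ^ (-s) h‖` and `‖D (S† h)‖` are equivalent norms then `S ∘ D` factors through
`Λ ^ (-s)` by an isomorphism. -/
theorem exists_equiv_of_norm_equiv {G : H →L[𝕜] H} (hG : G.IsSymmetric) (hGd : DenseRange G)
    {D : K →L[𝕜] K} (hD : D.IsSymmetric) (hDd : DenseRange D) (S : K ≃L[𝕜] H) {M N : ℝ}
    (h1 : ∀ h, ‖D (adjointEquiv S h)‖ ≤ M * ‖G h‖)
    (h2 : ∀ h, ‖G h‖ ≤ N * ‖D (adjointEquiv S h)‖) :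
    ∃ V : K ≃L[𝕜] H, ∀ c, G (V c) = S (D c) := by
  set e₂ : H →ₗ[𝕜] K := ((D ∘L (adjointEquiv S : H →L[𝕜] K) : H →L[𝕜] K) : H →ₗ[𝕜] K) with he₂
  have hd2 : DenseRange e₂ := hDd.comp (adjointEquiv S).surjective.denseRange D.continuous
  -- The two norm bounds make G h ↦ D S† h well defined and bounded in both directions between dense
  -- subspaces, so it extends to an isomorphism; its adjoint is the required one.
  let V : H ≃L[𝕜] K := (LinearEquiv.refl 𝕜 H).extend (G : H →ₗ[𝕜] H) e₂ hGd ⟨M, h1⟩ hd2 ⟨N, h2⟩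
  have hV : ∀ h, V (G h) = D (adjointEquiv S h) := fun h =>
    LinearMap.extendOfNorm_eq (f := e₂ ∘ₗ (LinearEquiv.refl 𝕜 H).toLinearMap)
      (e := (G : H →ₗ[𝕜] H)) hGd ⟨M, h1⟩ h
  refine ⟨adjointEquiv V, fun c => ext_inner_right 𝕜 fun h => ?_⟩
  have hG' : ∀ x y, inner 𝕜 (G x) y = inner 𝕜 x (G y) := hG
  have hD' : ∀ x y, inner 𝕜 (D x) y = inner 𝕜 x (D y) := hD
  have hS : inner 𝕜 (S (D c)) h = inner 𝕜 (D c) (adjointEquiv S h) :=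
    (ContinuousLinearMap.adjoint_inner_right (S : K →L[𝕜] H) (D c) h).symm
  rw [hG', inner_adjointEquiv_left, hV, hS, hD']

theorem synthesis_single {ι E : Type*} [DecidableEq ι] [NormedAddCommGroup E] [NormedSpace 𝕜 E]
    {θ : ι → E} {S : lp (fun _ : ι => 𝕜) 2 ≃L[𝕜] E} (hS : ∀ c, HasSum (fun i => c i • θ i) (S c))
    (i : ι) : S (lp.single 2 i 1) = θ i := by
  refine (hS _).unique ?_
  convert hasSum_single i ?_ using 1
  · simp
  · intro k hk
    simp [hk]

theorem isRieszBasis_of_single {ι E : Type*} [DecidableEq ι] [NormedAddCommGroup E]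
    [NormedSpace 𝕜 E] (S : lp (fun _ : ι => 𝕜) 2 ≃L[𝕜] E) :
    IsRieszBasis 𝕜 fun i => S (lp.single 2 i 1) := by
  refine ⟨S, fun c => ?_⟩
  have h : HasSum (fun i => S (lp.single 2 i (c i))) (S c) :=
    (lp.hasSum_single (by simp) c).mapL (S : lp (fun _ : ι => 𝕜) 2 →L[𝕜] E)
  convert h using 2 with i
  rw [← map_smul, ← lp.single_smul, smul_eq_mul, mul_one]

/-- If `θ` is a Riesz basis of `H` which, renormalized, is a Riesz basis of `X`, with norms in `X`
proportional to `2 ^ lev`, then `2 ^ (-s lev) θ` is a Riesz basis of `[H, X]_s`. -/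
theorem isRieszBasisOf_interpSpace {ι : Type*} (j : X →L[𝕜] H) (θ : ι → X) (lev : ι → ℕ)
    (hH : IsRieszBasis 𝕜 fun i => j (θ i))
    (hX : IsRieszBasis 𝕜 fun i => ((‖θ i‖⁻¹ : ℝ) : 𝕜) • θ i)
    (hlev : ∃ c C : ℝ, 0 < c ∧ ∀ i, c * 2 ^ lev i ≤ ‖θ i‖ ∧ ‖θ i‖ ≤ C * 2 ^ lev i)
    {s : ℝ} (hs : s ∈ Icc (0 : ℝ) 1) :
    IsRieszBasisOf (interpIncl j s)
      fun i => (((2 : ℝ) ^ (-(s * (lev i : ℝ))) : ℝ) : 𝕜) • j (θ i) := by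
  classical
  obtain ⟨S, hS⟩ := hH
  obtain ⟨SX, hSX⟩ := hX
  obtain ⟨a, b, ha, hab⟩ := hlev
  have hT := isPositive_invSqOp j
  have hθ : ∀ i, 0 < ‖θ i‖ := fun i => lt_of_lt_of_le (by positivity) (hab i).1
  have hd0 : ∀ i, (0 : ℝ) < 4⁻¹ ^ lev i := fun i => by positivity
  -- D is the model for T = Λ⁻² in coordinates: Λ corresponds to 2 ^ lev, whence the base 4⁻¹.
  obtain ⟨D, hD⟩ := exists_isDiag 𝕜 (d := fun i => (4⁻¹ : ℝ) ^ lev i) (K := 1) fun i => by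
    rw [abs_of_pos (hd0 i)]
    exact pow_le_one₀ (by norm_num) (by norm_num)
  obtain ⟨N, hN⟩ := exists_isDiag 𝕜 (d := fun i => ‖θ i‖⁻¹) (K := a⁻¹) fun i => by
    rw [abs_of_pos (inv_pos.mpr (hθ i))]
    refine inv_anti₀ ha (le_trans ?_ (hab i).1)
    exact le_mul_of_one_le_right ha.le (one_le_pow₀ one_le_two)
  have hDpos := hD.isPositive fun i => (hd0 i).le
  have hDi := hD.injective fun i => (hd0 i).ne'
  have hpow : ∀ t : ℝ, ∀ i, ((4⁻¹ : ℝ) ^ lev i) ^ (t / 2) = 2 ^ (-(t * (lev i : ℝ))) := by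
    intro t i
    have e : (4⁻¹ : ℝ) = 2 ^ (-2 : ℝ) := by
      rw [Real.rpow_neg two_pos.le]
      norm_num
    rw [← Real.rpow_natCast, ← Real.rpow_mul (by norm_num), e, ← Real.rpow_mul two_pos.le]
    ring_nf
  have hE : ∀ t : ℝ, 0 ≤ t → IsDiag (fracPow D (t / 2)) fun i => 2 ^ (-(t * (lev i : ℝ))) := by
    intro t ht
    have := hD.fracPow (fun i => (hd0 i).le) (div_nonneg ht two_pos.le)
    simpa only [hpow] using this
  have hpow1 : ∀ i, (2 : ℝ) ^ (-(1 * (lev i : ℝ))) = (2 ^ lev i)⁻¹ := by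
    intro i
    rw [one_mul, Real.rpow_neg two_pos.le, Real.rpow_natCast]
  have hNE : ∀ c, ‖N c‖ ≤ a⁻¹ * ‖fracPow D (1 / 2) c‖ := by
    refine hN.norm_apply_le (hE 1 zero_le_one) (by positivity) fun i => ?_
    rw [hpow1, abs_of_pos (inv_pos.mpr (hθ i)), abs_of_pos (by positivity), ← mul_inv]
    exact inv_anti₀ (by positivity) (hab i).1
  -- The absolute value is needed because the sign of b is unknown when the index type is empty.
  have hEN : ∀ c, ‖fracPow D (1 / 2) c‖ ≤ |b| * ‖N c‖ := by
    refine (hE 1 zero_le_one).norm_apply_le hN (abs_nonneg b) fun i => ?_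
    rw [hpow1, abs_of_pos (inv_pos.mpr (hθ i)), abs_of_pos (by positivity), ← div_eq_mul_inv,
      le_div_iff₀ (hθ i), inv_mul_le_iff₀ (by positivity), mul_comm]
    exact (hab i).2.trans (by gcongr; exact le_abs_self b)
  have hjS : ∀ c, j (SX c) = S (N c) := by
    intro c
    refine ((hSX c).mapL j).unique ?_
    convert hS (N c) using 2 with i
    rw [hN, map_smul, map_smul, smul_smul, mul_comm]
  set R := adjointEquiv S with hR
  set RX := adjointEquiv SX with hRX
  have hadj : ∀ h, RX (ContinuousLinearMap.adjoint j h) = N (R h) := by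
    intro h
    refine ext_inner_right 𝕜 fun c => ?_
    rw [hRX, inner_adjointEquiv_left, ContinuousLinearMap.adjoint_inner_left, hjS, hN.inner_left,
      hR, inner_adjointEquiv_left]
  -- Density of the range of j is not assumed: T h = 0 forces j† h = 0, hence N S† h = 0, and both N
  -- and S† are injective.
  have hTi : Function.Injective (invSqOp j) := by
    rw [injective_iff_map_eq_zero]
    intro h hh
    have h1 : fracPow (invSqOp j) (1 / 2) h = 0 := by
      have e := inner_fracPow_half_add_half hT zero_le_one h h
      rw [fracPow_one hT, hh, inner_zero_left] at e
      exact inner_self_eq_zero.mp e.symm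
    have h2 : ContinuousLinearMap.adjoint j h = 0 := by
      rw [← norm_eq_zero, ← norm_fracPow_invSqOp_half, h1, norm_zero]
    have h3 := hadj h
    rw [h2, map_zero] at h3
    have h4 := hN.injective (fun i => (inv_pos.mpr (hθ i)).ne') (h3.symm.trans (map_zero N).symm)
    simpa using h4
  have hst : s * (1 / 2) = s / 2 := by ring
  have hs2 : s / 2 ∈ Icc (0 : ℝ) 1 := ⟨by linarith [hs.1], by linarith [hs.2]⟩
  -- Heinz's inequality between the exponents 0 and 1/2, with parameter t = s. The maximum collects
  -- the constants of the two endpoints; `hb2` is the same for the inverse of R.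
  have hb1 : ∀ h, ‖fracPow D (s / 2) (R h)‖ ≤
      max ‖(R : H →L[𝕜] lp (fun _ : ι => 𝕜) 2)‖
        (|b| * ‖(RX : X →L[𝕜] lp (fun _ : ι => 𝕜) 2)‖) * ‖fracPow (invSqOp j) (s / 2) h‖ := by
    intro h
    rw [← hst]
    refine norm_fracPow_apply_le hT hTi hDpos (Q := (R : H →L[𝕜] lp (fun _ : ι => 𝕜) 2))
      (le_max_of_le_left (norm_nonneg _)) (by norm_num) (by norm_num) (fun x => ?_) (fun x => ?_)
      hs h
    · refine (ContinuousLinearMap.le_opNorm _ _).trans ?_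
      gcongr
      exact le_max_left _ _
    · calc ‖fracPow D (1 / 2) (R x)‖ ≤ |b| * ‖N (R x)‖ := hEN _
        _ ≤ |b| * (‖(RX : X →L[𝕜] lp (fun _ : ι => 𝕜) 2)‖ * ‖ContinuousLinearMap.adjoint j x‖) := by
            rw [← hadj]
            gcongr
            exact (RX : X →L[𝕜] lp (fun _ : ι => 𝕜) 2).le_opNorm _
        _ ≤ _ := by
            rw [norm_fracPow_invSqOp_half, ← mul_assoc]
            gcongr
            exact le_max_right _ _
  have hb2 : ∀ h, ‖fracPow (invSqOp j) (s / 2) h‖ ≤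
      max ‖(R.symm : lp (fun _ : ι => 𝕜) 2 →L[𝕜] H)‖
        (‖(RX.symm : lp (fun _ : ι => 𝕜) 2 →L[𝕜] X)‖ * a⁻¹) * ‖fracPow D (s / 2) (R h)‖ := by
    intro h
    rw [← hst]
    conv_lhs => rw [← R.symm_apply_apply h]
    refine norm_fracPow_apply_le hDpos hDi hT (Q := (R.symm : lp (fun _ : ι => 𝕜) 2 →L[𝕜] H))
      (le_max_of_le_left (norm_nonneg _)) (by norm_num) (by norm_num) (fun x => ?_) (fun x => ?_)
      hs (R h)
    · refine (ContinuousLinearMap.le_opNorm _ _).trans ?_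
      gcongr
      exact le_max_left _ _
    · have e : ContinuousLinearMap.adjoint j (R.symm x) = RX.symm (N x) := by
        rw [ContinuousLinearEquiv.eq_symm_apply, hadj, R.apply_symm_apply]
      calc ‖fracPow (invSqOp j) (1 / 2) (R.symm x)‖ = ‖RX.symm (N x)‖ := by
            rw [norm_fracPow_invSqOp_half, e]
        _ ≤ ‖(RX.symm : lp (fun _ : ι => 𝕜) 2 →L[𝕜] X)‖ * ‖N x‖ :=
            (RX.symm : lp (fun _ : ι => 𝕜) 2 →L[𝕜] X).le_opNorm _
        _ ≤ ‖(RX.symm : lp (fun _ : ι => 𝕜) 2 →L[𝕜] X)‖ * (a⁻¹ * ‖fracPow D (1 / 2) x‖) := by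
            gcongr
            exact hNE x
        _ ≤ _ := by
            rw [← mul_assoc]
            gcongr
            exact le_max_right _ _
  obtain ⟨V, hV⟩ := exists_equiv_of_norm_equiv (isPositive_fracPow hT hs2.1).isSymmetric
    (denseRange_fracPow hT hTi hs2) (isPositive_fracPow hDpos hs2.1).isSymmetric
    (denseRange_fracPow hDpos hDi hs2) S hb1 hb2
  refine ⟨_, fun i => ?_, isRieszBasis_of_single (V.trans (interpEquiv j s))⟩
  have hDs : fracPow D (s / 2) (lp.single 2 i (1 : 𝕜))
      = (((2 : ℝ) ^ (-(s * (lev i : ℝ))) : ℝ) : 𝕜) • lp.single 2 i (1 : 𝕜) := by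
    ext k
    rw [hE s hs.1, lp.coeFn_smul, Pi.smul_apply, smul_eq_mul]
    by_cases hk : k = i
    · rw [hk]
    · simp [hk]
  rw [ContinuousLinearEquiv.trans_apply, interpIncl_interpEquiv, hV, hDs, map_smul,
    synthesis_single hS]

end Interpolation

end

end HalfLineRiesz

/-! ### Application to the two Sobolev spaces on the half-line. -/

theorem mainTheorem10 {𝕜 : Type*} [RCLike 𝕜] {ιX ιY : Type*}
    (θX : ιX → HalfLineRiesz.H10Half 𝕜) (levX : ιX → ℕ)
    (θY : ιY → HalfLineRiesz.H1Half 𝕜) (levY : ιY → ℕ)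
    -- `Θ^X` is a Riesz basis of `L²`, renormalized in `H¹` it is a Riesz basis of `H¹_{0,{0}}`,
    -- and `‖θ_i‖_{H¹}` is proportional to `2 ^ |i|` up to constants
    (hX_L2 : HalfLineRiesz.IsRieszBasis 𝕜 fun i => HalfLineRiesz.H10ToL2 𝕜 (θX i))
    (hX_H1 : HalfLineRiesz.IsRieszBasis 𝕜 fun i => ((‖θX i‖⁻¹ : ℝ) : 𝕜) • θX i)
    (hX_lev : ∃ c C : ℝ, 0 < c ∧ ∀ i, c * 2 ^ levX i ≤ ‖θX i‖ ∧ ‖θX i‖ ≤ C * 2 ^ levX i)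
    -- the same for `Θ^Y` and `H¹`
    (hY_L2 : HalfLineRiesz.IsRieszBasis 𝕜 fun i => HalfLineRiesz.H1ToL2 𝕜 (θY i))
    (hY_H1 : HalfLineRiesz.IsRieszBasis 𝕜 fun i => ((‖θY i‖⁻¹ : ℝ) : 𝕜) • θY i)
    (hY_lev : ∃ c C : ℝ, 0 < c ∧ ∀ i, c * 2 ^ levY i ≤ ‖θY i‖ ∧ ‖θY i‖ ≤ C * 2 ^ levY i) :
    (∀ s ∈ Set.Icc (0 : ℝ) 1,
      HalfLineRiesz.IsRieszBasisOf (HalfLineRiesz.interpIncl (HalfLineRiesz.H10ToL2 𝕜) s)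
        (HalfLineRiesz.levelRescale levX s fun i => HalfLineRiesz.H10ToL2 𝕜 (θX i)) ∧
      HalfLineRiesz.IsRieszBasisOf (HalfLineRiesz.interpIncl (HalfLineRiesz.H1ToL2 𝕜) s)
        (HalfLineRiesz.levelRescale levY s fun i => HalfLineRiesz.H1ToL2 𝕜 (θY i))) ∧
    HalfLineRiesz.IsRieszBasisOf (HalfLineRiesz.HHalf00ToL2 𝕜)
      (HalfLineRiesz.levelRescale levX (1 / 2) fun i => HalfLineRiesz.H10ToL2 𝕜 (θX i)) ∧
    HalfLineRiesz.IsRieszBasisOf (HalfLineRiesz.HHalfToL2 𝕜)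
      (HalfLineRiesz.levelRescale levY (1 / 2) fun i => HalfLineRiesz.H1ToL2 𝕜 (θY i)) := by
  have hX : ∀ s ∈ Set.Icc (0 : ℝ) 1,
      HalfLineRiesz.IsRieszBasisOf (HalfLineRiesz.interpIncl (HalfLineRiesz.H10ToL2 𝕜) s)
        (HalfLineRiesz.levelRescale levX s fun i => HalfLineRiesz.H10ToL2 𝕜 (θX i)) := fun s hs =>
    HalfLineRiesz.isRieszBasisOf_interpSpace (HalfLineRiesz.H10ToL2 𝕜) θX levX hX_L2 hX_H1 hX_lev hs
  have hY : ∀ s ∈ Set.Icc (0 : ℝ) 1,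
      HalfLineRiesz.IsRieszBasisOf (HalfLineRiesz.interpIncl (HalfLineRiesz.H1ToL2 𝕜) s)
        (HalfLineRiesz.levelRescale levY s fun i => HalfLineRiesz.H1ToL2 𝕜 (θY i)) := fun s hs =>
    HalfLineRiesz.isRieszBasisOf_interpSpace (HalfLineRiesz.H1ToL2 𝕜) θY levY hY_L2 hY_H1 hY_lev hs
  have h2 : (1 / 2 : ℝ) ∈ Set.Icc (0 : ℝ) 1 := by constructor <;> norm_num
  exact ⟨fun s hs => ⟨hX s hs, hY s hs⟩, hX _ h2, hY _ h2⟩
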